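/- Let $\mathbb{M}=(M_j)_{j\ge 0}$ be a sequence of positive real numbers with $M_0=1$, put $\check M_j:=M_j/j!$, and let $\alpha>1$. Let $S_\alpha:=\{z\in\mathcal{R}:|\arg z|<\alpha\pi/2\}$ be the unbounded sector of opening $\alpha\pi$ in the Riemann surface $\mathcal{R}$ of the logarithm, and let $\mathcal{A}_{\{\mathbb{M}\}}(S_\alpha)$ be the class of all holomorphic $f:S_\alpha\to\mathbb{C}$ for which there is $h>0$ with $$\sup_{z\in S_\alpha,\ j\ge 0}\frac{|f^{(j)}(z)|}{h^jM_j}<\infty .$$ Two sequences $\mathbb{K},\mathbb{L}$ of positive numbers are called equivalent if there are $A,B>0$ with $K_j\le AB^jL_j$ and $L_j\le AB^jK_j$ for all $j\ge 0$. Suppose that there is $\alpha'>\alpha$ such that the sequence $(j^{(1-\alpha')j}M_j)_{j\ge 0}$ (with $0^0:=1$) is equivalent to a log-convex sequence $\mathbb{L}$ of positive numbers, i.e. $L_j^2\le L_{j-1}L_{j+1}$ for all $j\ge 1$. Then the following are equivalent: (a) $\mathbb{M}$ has the root almost increasing property (rai): there is $C>0$ such that $\check M_j^{1/j}\le C\,\check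 M_k^{1/k}$ for all $1\le j\le k$. (b) $\mathcal{A}_{\{\mathbb{M}\}}(S_\alpha)$ is holomorphically closed: $g\circ f\in\mathcal{A}_{\{\mathbb{M}\}}(S_\alpha)$ for all $f\in\mathcal{A}_{\{\mathbb{M}\}}(S_\alpha)$, all open $U\subseteq\mathbb{C}$ containing the closure of $f(S_\alpha)$, and all $g$ holomorphic in $U$. (c) $\mathcal{A}_{\{\mathbb{M}\}}(S_\alpha)$ is inverse-closed: $1/f\in\mathcal{A}_{\{\mathbb{M}\}}(S_\alpha)$ for all $f\in\mathcal{A}_{\{\mathbb{M}\}}(S_\alpha)$ with $\inf_{z\in S_\alpha}|f(z)|>0$. If moreover $\liminf_{j\to\infty}\check M_j^{1/j}>0$ and $\mathbb{M}$ satisfies (dc), i.e. there is $D\ge 1$ with $M_{j+1}\le D^{j+1}M_j$ for all $j\ge 0$, then (a), (b), (c) are also equivalent to each of the following: (d) $\mathcal{A}_{\{\mathbb{M}\}}(S_\alpha)$ is closed under composition: $g\circ f\in\mathcal{A}_{\{\mathbb{M}\}}(S_\alpha)$ for all $f\in\mathcal{A}_{\{\mathbb{M}\}}(S_\alpha)$,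 all open $U\subseteq\mathbb{C}$ containing the closure of $f(S_\alpha)$, and all $g$ holomorphic in $U$ such that for every compact $K\subset U$ there is $h>0$ with $\sup_{z\in K,\ j\ge 0}|g^{(j)}(z)|/(h^jM_j)<\infty$. (e) $\mathbb{M}$ has the Faà di Bruno property (FdB): there are $C\ge 1$ and $h\ge 1$ such that $\check M^\circ_j\le Ch^j\check M_j$ for all $j\ge 0$, where $\check M^\circ_0:=1$ and $$\check M^\circ_k:=\max\Big\{\check M_\ell\,\check M_{j_1}\cdots\check M_{j_\ell}:\ \ell\ge 1,\ j_1,\dots,j_\ell\ge 1,\ j_1+\cdots+j_\ell=k\Big\},\qquad k\ge 1 .$$ -/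

import Mathlib

open Filter Topology

namespace Ultraholomorphic

/-! ### Sequences of positive real numbers -/

/-- The sequence `M_j / j!`. -/
noncomputable def check (M : ℕ → ℝ) (j : ℕ) : ℝ := M j / (j.factorial : ℝ)

/-- Log-convexity `M_j ^ 2 ≤ M_{j-1} M_{j+1}` for all `j ≥ 1`, written with the index shifted. -/
def LogConvex (M : ℕ → ℝ) : Prop := ∀ j : ℕ, M (j + 1) ^ 2 ≤ M j * M (j + 2)

/-- The sequence `j ^ (j a)`, with `0 ^ 0 = 1`. -/
noncomputable def gevreyBar (a : ℝ) (j : ℕ) : ℝ := (j : ℝ) ^ ((j : ℝ) * a)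

/-- `M ≼ L`: there are `A, B > 0` with `M_j ≤ A B ^ j L_j` for all `j`. -/
def Preceq (M L : ℕ → ℝ) : Prop :=
  ∃ A > (0 : ℝ), ∃ B > (0 : ℝ), ∀ j : ℕ, M j ≤ A * B ^ j * L j

/-- Equivalence of sequences. -/
def Equivalent (M L : ℕ → ℝ) : Prop := Preceq M L ∧ Preceq L M

/-- Root almost increasing property (rai). -/
def RootAlmostIncreasing (M : ℕ → ℝ) : Prop :=
  ∃ C > (0 : ℝ), ∀ j k : ℕ, 1 ≤ j → j ≤ k →
    check M j ^ (1 / (j : ℝ)) ≤ C * check M k ^ (1 / (k : ℝ))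

/-- Derivation closedness (dc). -/
def DerivationClosed (M : ℕ → ℝ) : Prop :=
  ∃ D : ℝ, 1 ≤ D ∧ ∀ j : ℕ, M (j + 1) ≤ D ^ (j + 1) * M j

/-- For a sequence `N`, the sequence `N°` with `N°_0 = 1` and, for `k ≥ 1`, `N°_k` the maximum of
`N_ℓ N_{j_1} ⋯ N_{j_ℓ}` over all `j_1, …, j_ℓ ≥ 1` with `j_1 + ⋯ + j_ℓ = k`. -/
noncomputable def circ (N : ℕ → ℝ) (k : ℕ) : ℝ :=
  if k = 0 then 1
  else (Finset.univ : Finset (Composition k)).sup' Finset.univ_nonempty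
    (fun c => N c.length * ∏ i : Fin c.length, N (c.blocksFun i))

/-- Faà di Bruno property (FdB). -/
def FaaDiBruno (M : ℕ → ℝ) : Prop :=
  ∃ C : ℝ, 1 ≤ C ∧ ∃ h : ℝ, 1 ≤ h ∧
    ∀ j : ℕ, circ (check M) j ≤ C * h ^ j * check M j

/-- `liminf (M_j / j!) ^ (1 / j) > 0`, the lower limit being taken in `[0, ∞]`. -/
def LiminfRootPos (M : ℕ → ℝ) : Prop :=
  0 < liminf (fun j : ℕ => ENNReal.ofReal (check M j ^ (1 / (j : ℝ)))) atTop

/-! ### Sectors of the Riemann surface of the logarithm -/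

/-- The Riemann surface of the logarithm, given by its global holomorphic coordinate `ζ = log z`.
The covering map onto `ℂ ∖ {0}` is `z = exp ζ`, and `|z| = exp (re ζ)`, `arg z = im ζ`. -/
abbrev LogSurface : Type := ℂ

/-- The argument of a point of the Riemann surface of the logarithm. -/
def LogSurface.arg (ζ : LogSurface) : ℝ := Complex.im ζ

/-- The unbounded sector `S_α = {z : |arg z| < α π / 2}`. -/
def sector (α : ℝ) : Set LogSurface := {ζ | |LogSurface.arg ζ| < α * Real.pi / 2}

/-- The derivative `d f / d z` of a function on the surface with respect to `z = exp ζ`. -/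
noncomputable def zderiv (f : LogSurface → ℂ) : LogSurface → ℂ :=
  fun ζ => Complex.exp (-ζ) * deriv f ζ

/-- If near `ζ` the function `f` is a function `F` of the variable `z = exp ζ`,
then `zderiv f ζ` is the derivative of `F` at the point `exp ζ`. -/
theorem zderiv_eq_of_eventuallyEq {f : LogSurface → ℂ} {F : ℂ → ℂ} {ζ : LogSurface}
    (hF : DifferentiableAt ℂ F (Complex.exp ζ))
    (h : f =ᶠ[𝓝 ζ] fun w => F (Complex.exp w)) :
    zderiv f ζ = deriv F (Complex.exp ζ) := by
  have h1 : deriv f ζ = deriv F (Complex.exp ζ) * Complex.exp ζ := by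
    rw [h.deriv_eq]
    exact (hF.hasDerivAt.comp ζ (Complex.hasDerivAt_exp ζ)).deriv
  rw [zderiv, h1, Complex.exp_neg]
  field_simp [Complex.exp_ne_zero ζ]

/-- The ultraholomorphic class of Roumieu type of `M` in `S_α`: the functions holomorphic in `S_α`
such that, for some `h > 0`, `|f^(j)(z)| / (h ^ j M_j)` is bounded over `z ∈ S_α` and `j ∈ ℕ`.
Only the values of `f` in `S_α` matter. -/
def ultraClass (M : ℕ → ℝ) (α : ℝ) : Set (LogSurface → ℂ) :=
  {f | DifferentiableOn ℂ f (sector α) ∧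
    ∃ h > (0 : ℝ), ∃ C : ℝ, ∀ ζ ∈ sector α, ∀ j : ℕ, ‖zderiv^[j] f ζ‖ ≤ C * (h ^ j * M j)}

/-- The functions holomorphic in `U ⊆ ℂ` such that, for every compact `K ⊆ U`, there is `h > 0`
for which `|g^(j)(z)| / (h ^ j M_j)` is bounded over `z ∈ K` and `j ∈ ℕ`. -/
def localClass (M : ℕ → ℝ) (U : Set ℂ) : Set (ℂ → ℂ) :=
  {g | DifferentiableOn ℂ g U ∧
    ∀ K : Set ℂ, IsCompact K → K ⊆ U →
      ∃ h > (0 : ℝ), ∃ C : ℝ, ∀ z ∈ K, ∀ j : ℕ, ‖iteratedDeriv j g z‖ ≤ C * (h ^ j * M j)}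

/-! ### Stability properties -/

/-- The class of `M` in `S_α` is holomorphically closed. -/
def HolomorphicallyClosed (M : ℕ → ℝ) (α : ℝ) : Prop :=
  ∀ f ∈ ultraClass M α, ∀ U : Set ℂ, IsOpen U → closure (f '' sector α) ⊆ U →
    ∀ g : ℂ → ℂ, DifferentiableOn ℂ g U → g ∘ f ∈ ultraClass M α

/-- The class of `M` in `S_α` is inverse-closed: it contains `1 / f` for every `f` in the class
such that the infimum of `|f|` over `S_α` is positive. -/
def InverseClosed (M : ℕ → ℝ) (α : ℝ) : Prop :=
  ∀ f ∈ ultraClass M α, (∃ c > (0 : ℝ), ∀ ζ ∈ sector α, c ≤ ‖f ζ‖) →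
    (fun ζ => 1 / f ζ) ∈ ultraClass M α

/-- The class of `M` in `S_α` is closed under composition. -/
def CompositionClosed (M : ℕ → ℝ) (α : ℝ) : Prop :=
  ∀ f ∈ ultraClass M α, ∀ U : Set ℂ, IsOpen U → closure (f '' sector α) ⊆ U →
    ∀ g ∈ localClass M U, g ∘ f ∈ ultraClass M α

end Ultraholomorphic

/-!
The cycle is rai ⇒ holomorphically closed ⇒ inverse-closed ⇒ rai; the two further properties are
reached by rai ⇒ Faà di Bruno (using dc) ⇒ closed under composition ⇒ holomorphically closed (using the positive lower limit).

*Composition.* Near each point a function on the sector is a holomorphic function of `z = exp ζ`, so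
the Taylor coefficients of `g ∘ f` are sums over compositions (`zderiv_iterate_comp`). If
`Q_ℓ M̌_{j_1} ⋯ M̌_{j_ℓ}` is controlled by `M̌_k` for `j_1 + ⋯ + j_ℓ = k`, where `Q` bounds the Taylor
coefficients of `g`, then `g ∘ f` is in the class (`comp_mem_ultraClass`). Cauchy's estimates give
`Q = 1` for holomorphic `g`, and rai is exactly what this needs; for `g` in the class, `Q = M̌` and
the condition is the Faà di Bruno property.

*Inverse-closed ⇒ rai.* With `β = α' - 1 > α - 1`, the Laplace transform
`E(z) = ∫₀^∞ exp (-t - z t ^ β) dt` is completely monotone on `(0, ∞)`, and rotating the ray of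
integration continues it to the sector of opening `α π` with derivatives of size `j ^ (j β)`
(`laplaceLine_eq_laplaceLine`, `exists_norm_laplaceGevrey_le`, `exists_le_laplaceGevrey`).
As `M_j` is equivalent to `j ^ (j β) L_j` with `L` log-convex, a superposition of dilates of `E` is
a completely monotone `f` in the class whose derivatives near `0` are comparable to `M_j`
(`exists_completelyMonotone_mem_ultraClass`). For a constant `c > sup |f|`, the function `c - f` is
bounded away from `0`, and up to the sign `(-1) ^ k` the Taylor coefficients of `1 / (c - f)` are
sums of nonnegative terms, among them the products of Taylor coefficients of `f`. Hence
`M̌_{j_1} ⋯ M̌_{j_ℓ} ≤ C H ^ k M̌_k` whenever `j_1 + ⋯ + j_ℓ = k`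
(`InverseClosed.exists_prod_check_le`). Taking all indices but one equal to `p`, and the last one
between `p` and `2 p`, yields rai.
-/

namespace Ultraholomorphic

/-! ### Faà di Bruno's formula on the surface of the logarithm -/

theorem isOpen_sector (α : ℝ) : IsOpen (sector α) :=
  isOpen_lt (continuous_abs.comp Complex.continuous_im) continuous_const

/-- If near `ζ` the function `f` is a function `F` of the variable `z = exp ζ`, then its
derivatives with respect to `z` are those of `F`. -/
theorem zderiv_iterate_eventuallyEq {f : LogSurface → ℂ} {F : ℂ → ℂ} {ζ : LogSurface}
    (hF : AnalyticAt ℂ F (Complex.exp ζ)) (h : f =ᶠ[𝓝 ζ] fun w => F (Complex.exp w)) (j : ℕ) :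
    zderiv^[j] f =ᶠ[𝓝 ζ] fun w => iteratedDeriv j F (Complex.exp w) := by
  induction j with
  | zero => simpa using h
  | succ j ih =>
    have hF' : AnalyticAt ℂ (iteratedDeriv j F) (Complex.exp ζ) := by
      rw [iteratedDeriv_eq_iterate]; exact hF.iterated_deriv j
    have h1 : ∀ᶠ w in 𝓝 ζ, AnalyticAt ℂ (iteratedDeriv j F) (Complex.exp w) :=
      Complex.continuous_exp.continuousAt.eventually hF'.eventually_analyticAt
    filter_upwards [ih.eventually_nhds, h1] with w hw1 hw2
    rw [Function.iterate_succ_apply', iteratedDeriv_succ]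
    exact zderiv_eq_of_eventuallyEq hw2.differentiableAt hw1

/-- Every function holomorphic at `ζ` is near `ζ` a holomorphic function of `z = exp ζ`. -/
theorem exists_local_function_of_exp {f : LogSurface → ℂ} {ζ : LogSurface}
    (hf : AnalyticAt ℂ f ζ) :
    ∃ F : ℂ → ℂ, AnalyticAt ℂ F (Complex.exp ζ) ∧ f =ᶠ[𝓝 ζ] fun w => F (Complex.exp w) := by
  have h0 : Complex.exp ζ * Complex.exp (-ζ) = 1 := by rw [← Complex.exp_add]; simp
  refine ⟨fun z => f (ζ + Complex.log (z * Complex.exp (-ζ))), ?_, ?_⟩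
  · have h1 : AnalyticAt ℂ (fun z => ζ + Complex.log (z * Complex.exp (-ζ))) (Complex.exp ζ) :=
      analyticAt_const.add
        ((analyticAt_id.mul analyticAt_const).clog (by simp [h0]))
    refine AnalyticAt.fun_comp ?_ h1
    simpa [h0] using hf
  · have h1 : ∀ᶠ w in 𝓝 ζ, |(w - ζ).im| < Real.pi := by
      have : ContinuousAt (fun w : ℂ => |(w - ζ).im|) ζ := by fun_prop
      exact this.eventually (gt_mem_nhds (by simpa using Real.pi_pos))
    filter_upwards [h1] with w hw
    rw [← Complex.exp_add, ← sub_eq_add_neg, Complex.log_exp (abs_lt.1 hw).1 (abs_lt.1 hw).2.le]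
    simp

theorem iteratedDeriv_comp_eq_sum_composition {g F : ℂ → ℂ} {z : ℂ} (hF : AnalyticAt ℂ F z)
    (hg : AnalyticAt ℂ g (F z)) (n : ℕ) :
    iteratedDeriv n (g ∘ F) z / n.factorial = ∑ c : Composition n,
      (iteratedDeriv c.length g (F z) / c.length.factorial) *
        ∏ i, (iteratedDeriv (c.blocksFun i) F z / (c.blocksFun i).factorial) := by
  have h1 := (hg.hasFPowerSeriesAt.comp hF.hasFPowerSeriesAt).eq_formalMultilinearSeries
    (hg.comp hF).hasFPowerSeriesAt
  have h2 := congrArg (fun p : FormalMultilinearSeries ℂ ℂ ℂ => p.coeff n) h1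
  simp only [FormalMultilinearSeries.coeff_ofScalars] at h2
  rw [← h2]
  simp only [FormalMultilinearSeries.coeff, FormalMultilinearSeries.comp,
    sum_apply, FormalMultilinearSeries.compAlongComposition_apply]
  refine Finset.sum_congr rfl fun c _ => ?_
  rw [FormalMultilinearSeries.apply_eq_prod_smul_coeff, FormalMultilinearSeries.coeff_ofScalars,
    smul_eq_mul, mul_comm]
  congr 1
  refine Finset.prod_congr rfl fun i _ => ?_
  simp [FormalMultilinearSeries.applyComposition, FormalMultilinearSeries.apply_eq_prod_smul_coeff,
    FormalMultilinearSeries.coeff_ofScalars]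

/-- Faà di Bruno's formula, as a sum over compositions: the Taylor coefficients of `g ∘ f`. -/
theorem zderiv_iterate_comp {f : LogSurface → ℂ} {g : ℂ → ℂ} {ζ : LogSurface}
    (hf : AnalyticAt ℂ f ζ) (hg : AnalyticAt ℂ g (f ζ)) (n : ℕ) :
    zderiv^[n] (g ∘ f) ζ / n.factorial = ∑ c : Composition n,
      (iteratedDeriv c.length g (f ζ) / c.length.factorial) *
        ∏ i, (zderiv^[c.blocksFun i] f ζ / (c.blocksFun i).factorial) := by
  obtain ⟨F, hF, hfF⟩ := exists_local_function_of_exp hf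
  have hg' : AnalyticAt ℂ g (F (Complex.exp ζ)) := by rwa [← hfF.eq_of_nhds]
  have hgf : (g ∘ f) =ᶠ[𝓝 ζ] fun w => (g ∘ F) (Complex.exp w) := hfF.fun_comp g
  rw [(zderiv_iterate_eventuallyEq (hg'.comp hF) hgf n).eq_of_nhds,
    iteratedDeriv_comp_eq_sum_composition hF hg', ← hfF.eq_of_nhds]
  simp only [fun j => (zderiv_iterate_eventuallyEq hF hfF j).eq_of_nhds]

/-! ### Composition with functions of controlled growth -/

theorem check_pos {M : ℕ → ℝ} (hM : ∀ j, 0 < M j) (j : ℕ) : 0 < check M j :=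
  div_pos (hM j) (by exact_mod_cast j.factorial_pos)

theorem analyticAt_of_mem_ultraClass {M : ℕ → ℝ} {α : ℝ} {f : LogSurface → ℂ}
    (hf : f ∈ ultraClass M α) {ζ : LogSurface} (hζ : ζ ∈ sector α) : AnalyticAt ℂ f ζ :=
  hf.1.analyticAt ((isOpen_sector α).mem_nhds hζ)

theorem isCompact_closure_image_of_mem_ultraClass {M : ℕ → ℝ} {α : ℝ} {f : LogSurface → ℂ}
    (hf : f ∈ ultraClass M α) : IsCompact (closure (f '' sector α)) := by
  obtain ⟨-, h, -, C, hC⟩ := hf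
  refine Metric.isCompact_of_isClosed_isBounded isClosed_closure (Bornology.IsBounded.closure ?_)
  refine isBounded_iff_forall_norm_le.2 ⟨C * (h ^ 0 * M 0), ?_⟩
  rintro _ ⟨ζ, hζ, rfl⟩
  exact hC ζ hζ 0

/-- If the weights `Q` control the Taylor coefficients of `g` on the image of `f`, and if
`Q_ℓ M̌_{j_1} ⋯ M̌_{j_ℓ}` is controlled by `M̌_{j_1 + ⋯ + j_ℓ}`, then `g ∘ f` is in the class. -/
theorem comp_mem_ultraClass {M : ℕ → ℝ} (hM : ∀ j, 0 < M j) {α : ℝ} {f : LogSurface → ℂ}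
    (hf : f ∈ ultraClass M α) {U : Set ℂ} (hU : IsOpen U) (hfU : closure (f '' sector α) ⊆ U)
    {g : ℂ → ℂ} (hg : DifferentiableOn ℂ g U) {Q : ℕ → ℝ} (hQ : ∀ j, 0 ≤ Q j)
    (hgQ : ∃ h > (0 : ℝ), ∃ C : ℝ, ∀ z ∈ closure (f '' sector α), ∀ j : ℕ,
      ‖iteratedDeriv j g z / j.factorial‖ ≤ C * (h ^ j * Q j))
    {A B : ℝ} (hB : 0 < B) (hQM : ∀ (n : ℕ) (c : Composition n),
      Q c.length * ∏ i, check M (c.blocksFun i) ≤ A * B ^ n * check M n) :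
    g ∘ f ∈ ultraClass M α := by
  have hmaps : Set.MapsTo f (sector α) U := fun ζ hζ =>
    hfU (subset_closure (Set.mem_image_of_mem f hζ))
  refine ⟨hg.comp hf.1 hmaps, ?_⟩
  obtain ⟨h₁, hh₁, C₁, hC₁⟩ := hgQ
  have hf' := hf
  obtain ⟨-, h₂, hh₂, C₂, hC₂⟩ := hf'
  -- all constants are enlarged so as to be at least `1`
  set D₁ := max C₁ 1
  set D₂ := max C₂ 1
  set k₁ := max h₁ 1
  have hD₁ : 1 ≤ D₁ := le_max_right _ _
  have hD₂ : 1 ≤ D₂ := le_max_right _ _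
  have hk₁ : 1 ≤ k₁ := le_max_right _ _
  refine ⟨2 * (k₁ * D₂ * h₂ * B), by positivity, D₁ * A, fun ζ hζ n => ?_⟩
  have hn : (0 : ℝ) < n.factorial := by exact_mod_cast n.factorial_pos
  have hz : f ζ ∈ closure (f '' sector α) := subset_closure (Set.mem_image_of_mem f hζ)
  have hfac := zderiv_iterate_comp (analyticAt_of_mem_ultraClass hf hζ)
    (hg.analyticAt (hU.mem_nhds (hfU hz))) n
  have hterm : ∀ c : Composition n, ‖(iteratedDeriv c.length g (f ζ) / c.length.factorial) *
        ∏ i, (zderiv^[c.blocksFun i] f ζ / (c.blocksFun i).factorial)‖ ≤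
      D₁ * (k₁ * D₂ * h₂) ^ n * (A * B ^ n * check M n) := by
    intro c
    have hlen : c.length ≤ n := c.length_le
    have h1 : ‖iteratedDeriv c.length g (f ζ) / c.length.factorial‖ ≤
        D₁ * k₁ ^ n * Q c.length := by
      refine (hC₁ _ hz _).trans ?_
      have := hQ c.length
      calc C₁ * (h₁ ^ c.length * Q c.length) ≤ D₁ * (k₁ ^ n * Q c.length) := by
            refine mul_le_mul (le_max_left _ _) ?_ (by positivity) (by positivity)
            refine mul_le_mul_of_nonneg_right ?_ this
            exact (pow_le_pow_left₀ hh₁.le (le_max_left _ _) _).trans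
              (pow_le_pow_right₀ hk₁ hlen)
        _ = _ := by ring
    have h2 : ‖∏ i, (zderiv^[c.blocksFun i] f ζ / ((c.blocksFun i).factorial : ℂ))‖ ≤
        D₂ ^ n * h₂ ^ n * ∏ i, check M (c.blocksFun i) := by
      rw [norm_prod]
      calc ∏ i, ‖zderiv^[c.blocksFun i] f ζ / ((c.blocksFun i).factorial : ℂ)‖
          ≤ ∏ i, (D₂ * h₂ ^ c.blocksFun i * check M (c.blocksFun i)) := by
            refine Finset.prod_le_prod (fun _ _ => norm_nonneg _) fun i _ => ?_
            have hi : (0 : ℝ) < (c.blocksFun i).factorial := by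
              exact_mod_cast Nat.factorial_pos _
            rw [norm_div, Complex.norm_natCast, check, ← mul_div_assoc]
            refine div_le_div_of_nonneg_right ((hC₂ ζ hζ _).trans ?_) hi.le
            rw [mul_assoc]
            have := hM (c.blocksFun i)
            exact mul_le_mul_of_nonneg_right (le_max_left _ _) (by positivity)
        _ = D₂ ^ c.length * h₂ ^ n * ∏ i, check M (c.blocksFun i) := by
            rw [Finset.prod_mul_distrib, Finset.prod_mul_distrib, Finset.prod_pow_eq_pow_sum,
              c.sum_blocksFun]
            simp
        _ ≤ _ := by
            have : 0 ≤ ∏ i, check M (c.blocksFun i) :=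
              Finset.prod_nonneg fun i _ => (check_pos hM _).le
            gcongr
    have hP : 0 ≤ ∏ i, check M (c.blocksFun i) :=
      Finset.prod_nonneg fun i _ => (check_pos hM _).le
    rw [norm_mul]
    calc _ ≤ (D₁ * k₁ ^ n * Q c.length) * (D₂ ^ n * h₂ ^ n * ∏ i, check M (c.blocksFun i)) :=
          mul_le_mul h1 h2 (norm_nonneg _) (by have := hQ c.length; positivity)
      _ = D₁ * (k₁ * D₂ * h₂) ^ n * (Q c.length * ∏ i, check M (c.blocksFun i)) := by ring
      _ ≤ _ := mul_le_mul_of_nonneg_left (hQM n c) (by positivity)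
  have hA : 0 ≤ A * B ^ n * check M n := by
    refine le_trans ?_ (hQM n (Composition.ones n))
    exact mul_nonneg (hQ _) (Finset.prod_nonneg fun i _ => (check_pos hM _).le)
  have hsum : ‖zderiv^[n] (g ∘ f) ζ / n.factorial‖ ≤
      2 ^ n * (D₁ * (k₁ * D₂ * h₂) ^ n * (A * B ^ n * check M n)) := by
    rw [hfac]
    refine (norm_sum_le_of_le _ fun c _ => hterm c).trans ?_
    rw [Finset.sum_const, Finset.card_univ, composition_card, nsmul_eq_mul]
    refine mul_le_mul_of_nonneg_right ?_ (by positivity)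
    push_cast
    exact pow_le_pow_right₀ (by norm_num) (Nat.sub_le _ _)
  rw [norm_div, Complex.norm_natCast, div_le_iff₀ hn] at hsum
  refine hsum.trans (le_of_eq ?_)
  rw [check]
  field_simp
  ring

/-! ### Consequences of the root almost increasing property -/

/-- Under (rai), `M̌_{j_1} ⋯ M̌_{j_ℓ} ≤ C ^ k M̌_k` whenever `j_1 + ⋯ + j_ℓ = k`. -/
theorem RootAlmostIncreasing.exists_prod_le {M : ℕ → ℝ} (hM : ∀ j, 0 < M j) (hM0 : M 0 = 1)
    (h : RootAlmostIncreasing M) :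
    ∃ C > (0 : ℝ), ∀ (ι : Type) (s : Finset ι) (e : ι → ℕ) (k : ℕ), ∑ i ∈ s, e i = k →
      ∏ i ∈ s, check M (e i) ≤ C ^ k * check M k := by
  obtain ⟨C, hC, hCM⟩ := h
  refine ⟨C, hC, fun ι s e k hk => ?_⟩
  set m := C * check M k ^ (1 / (k : ℝ)) with hm
  have hcheck0 : check M 0 = 1 := by simp [check, hM0]
  have hm0 : 0 ≤ m := mul_nonneg hC.le (Real.rpow_nonneg (check_pos hM k).le _)
  have hle : ∀ j ≤ k, check M j ≤ m ^ j := by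
    intro j hj
    rcases Nat.eq_zero_or_pos j with rfl | hj0
    · simp [hcheck0]
    · calc check M j = (check M j ^ (1 / (j : ℝ))) ^ j := by
            rw [one_div, Real.rpow_inv_natCast_pow (check_pos hM j).le hj0.ne']
        _ ≤ m ^ j := pow_le_pow_left₀ (Real.rpow_nonneg (check_pos hM j).le _) (hCM j k hj0 hj) _
  calc ∏ i ∈ s, check M (e i) ≤ ∏ i ∈ s, m ^ e i :=
        Finset.prod_le_prod (fun i _ => (check_pos hM _).le) fun i hi =>
          hle _ (hk ▸ Finset.single_le_sum (f := e) (fun _ _ => Nat.zero_le _) hi)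
    _ = m ^ k := by rw [Finset.prod_pow_eq_pow_sum, hk]
    _ = C ^ k * check M k := by
        rcases Nat.eq_zero_or_pos k with rfl | hk0
        · simp [hcheck0]
        · rw [hm, mul_pow, one_div, Real.rpow_inv_natCast_pow (check_pos hM k).le hk0.ne']

/-- Cauchy's estimates, uniformly on a compact set. -/
theorem exists_norm_iteratedDeriv_div_factorial_le {U K : Set ℂ} (hU : IsOpen U)
    (hK : IsCompact K) (hKU : K ⊆ U) {g : ℂ → ℂ} (hg : DifferentiableOn ℂ g U) :
    ∃ h > (0 : ℝ), ∃ C : ℝ, ∀ z ∈ K, ∀ j : ℕ,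
      ‖iteratedDeriv j g z / j.factorial‖ ≤ C * h ^ j := by
  obtain ⟨δ, hδ, hδU⟩ := hK.exists_cthickening_subset_open hU hKU
  obtain ⟨C, hC⟩ := hK.cthickening.exists_bound_of_continuousOn
    (hg.continuousOn.mono hδU)
  refine ⟨δ⁻¹, inv_pos.2 hδ, C, fun z hz j => ?_⟩
  have hball : Metric.closedBall z δ ⊆ Metric.cthickening δ K :=
    Metric.closedBall_subset_cthickening hz δ
  have hdiff : DiffContOnCl ℂ g (Metric.ball z δ) := by
    refine DifferentiableOn.diffContOnCl_ball (U := U) hg (hball.trans hδU)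
  have h1 := Complex.norm_iteratedDeriv_le_of_forall_mem_sphere_norm_le j hδ hdiff
    fun w hw => hC w (hball (Metric.sphere_subset_closedBall hw))
  have hj : (0 : ℝ) < j.factorial := by exact_mod_cast j.factorial_pos
  rw [norm_div, Complex.norm_natCast, div_le_iff₀ hj]
  refine h1.trans (le_of_eq ?_)
  rw [inv_pow]; ring

theorem RootAlmostIncreasing.holomorphicallyClosed {M : ℕ → ℝ} (hM : ∀ j, 0 < M j)
    (hM0 : M 0 = 1) (h : RootAlmostIncreasing M) (α : ℝ) : HolomorphicallyClosed M α := by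
  intro f hf U hU hfU g hg
  obtain ⟨C, hC, hprod⟩ := h.exists_prod_le hM hM0
  refine comp_mem_ultraClass hM hf hU hfU hg (Q := fun _ => 1) (fun _ => zero_le_one) ?_ (A := 1)
    hC fun n c => ?_
  · simpa using exists_norm_iteratedDeriv_div_factorial_le hU
      (isCompact_closure_image_of_mem_ultraClass hf) hfU hg
  · simpa using hprod _ Finset.univ c.blocksFun n c.sum_blocksFun

theorem HolomorphicallyClosed.inverseClosed {M : ℕ → ℝ} {α : ℝ}
    (h : HolomorphicallyClosed M α) : InverseClosed M α := by
  rintro f hf ⟨c, hc, hcf⟩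
  have h0 : closure (f '' sector α) ⊆ {0}ᶜ := by
    have h1 : closure (f '' sector α) ⊆ {w | c ≤ ‖w‖} := by
      refine closure_minimal ?_ (isClosed_le continuous_const continuous_norm)
      rintro _ ⟨ζ, hζ, rfl⟩
      exact hcf ζ hζ
    intro w hw hw0
    have h2 : c ≤ ‖w‖ := h1 hw
    rw [Set.mem_singleton_iff.1 hw0, norm_zero] at h2
    exact hc.not_ge h2
  refine h f hf {0}ᶜ isOpen_compl_singleton h0 (fun w => 1 / w) ?_
  intro w hw
  exact (by fun_prop (disch := exact hw) : DifferentiableAt ℂ (fun w : ℂ => 1 / w) w).differentiableWithinAt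

/-! ### Composition with functions of the class -/

theorem LiminfRootPos.exists_one_le {M : ℕ → ℝ} (hM : ∀ j, 0 < M j) (h : LiminfRootPos M) :
    ∃ h > (0 : ℝ), ∃ C > (0 : ℝ), ∀ j, 1 ≤ C * (h ^ j * check M j) := by
  obtain ⟨ε, hε0, hε⟩ := exists_between h
  have hev := eventually_lt_of_lt_liminf hε
  have hεtop : ε ≠ ⊤ := (hε.trans_le le_top).ne
  set c := ε.toReal with hc
  have hc0 : 0 < c := ENNReal.toReal_pos hε0.ne' hεtop
  obtain ⟨N, hN⟩ := eventually_atTop.1 hev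
  have hterm : ∀ j, 0 < c⁻¹ ^ j * check M j := fun j =>
    mul_pos (by positivity) (check_pos hM j)
  refine ⟨c⁻¹, inv_pos.2 hc0, 1 + ∑ j ∈ Finset.range (N + 1), (c⁻¹ ^ j * check M j)⁻¹, ?_,
    fun j => ?_⟩
  · have : 0 ≤ ∑ j ∈ Finset.range (N + 1), (c⁻¹ ^ j * check M j)⁻¹ :=
      Finset.sum_nonneg fun j _ => (inv_pos.2 (hterm j)).le
    positivity
  have hsum : 0 ≤ ∑ j ∈ Finset.range (N + 1), (c⁻¹ ^ j * check M j)⁻¹ :=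
    Finset.sum_nonneg fun j _ => (inv_pos.2 (hterm j)).le
  rcases lt_or_ge j (N + 1) with hj | hj
  · have h1 : (c⁻¹ ^ j * check M j)⁻¹ ≤ ∑ j ∈ Finset.range (N + 1), (c⁻¹ ^ j * check M j)⁻¹ :=
      Finset.single_le_sum (f := fun j => (c⁻¹ ^ j * check M j)⁻¹)
        (fun j _ => (inv_pos.2 (hterm j)).le) (Finset.mem_range.2 hj)
    calc (1 : ℝ) = (c⁻¹ ^ j * check M j)⁻¹ * (c⁻¹ ^ j * check M j) :=
          (inv_mul_cancel₀ (hterm j).ne').symm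
      _ ≤ _ := mul_le_mul_of_nonneg_right (by linarith) (hterm j).le
  · have hj0 : j ≠ 0 := by omega
    have h1 : c ≤ check M j ^ (1 / (j : ℝ)) := by
      have := (hN j (by omega)).le
      rw [hc]
      exact ENNReal.toReal_le_of_le_ofReal (Real.rpow_nonneg (check_pos hM j).le _) this
    have h2 : c ^ j ≤ check M j := by
      calc c ^ j ≤ (check M j ^ (1 / (j : ℝ))) ^ j := pow_le_pow_left₀ hc0.le h1 _
        _ = check M j := by rw [one_div, Real.rpow_inv_natCast_pow (check_pos hM j).le hj0]
    have h3 : 1 ≤ c⁻¹ ^ j * check M j := by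
      rw [inv_pow, ← div_eq_inv_mul]; exact (one_le_div (by positivity)).2 h2
    nlinarith [hterm j]

theorem CompositionClosed.holomorphicallyClosed {M : ℕ → ℝ} (hM : ∀ j, 0 < M j)
    (hlim : LiminfRootPos M) {α : ℝ} (h : CompositionClosed M α) : HolomorphicallyClosed M α := by
  intro f hf U hU hfU g hg
  refine h f hf U hU hfU g ⟨hg, fun K hK hKU => ?_⟩
  obtain ⟨h₁, hh₁, C₁, hC₁⟩ := exists_norm_iteratedDeriv_div_factorial_le hU hK hKU hg
  obtain ⟨h₂, hh₂, C₂, hC₂0, hC₂⟩ := hlim.exists_one_le hM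
  refine ⟨h₁ * h₂, by positivity, C₁ * C₂, fun z hz j => ?_⟩
  have hj : (0 : ℝ) < j.factorial := by exact_mod_cast j.factorial_pos
  have h1 := hC₁ z hz j
  have h2 : 0 ≤ C₁ * h₁ ^ j := (norm_nonneg _).trans h1
  rw [norm_div, Complex.norm_natCast, div_le_iff₀ hj] at h1
  calc _ ≤ C₁ * h₁ ^ j * j.factorial := h1
    _ ≤ C₁ * h₁ ^ j * j.factorial * (C₂ * (h₂ ^ j * check M j)) :=
        le_mul_of_one_le_right (by positivity) (hC₂ j)
    _ = _ := by rw [check]; field_simp; ring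

theorem le_circ {N : ℕ → ℝ} (hN0 : N 0 = 1) {n : ℕ} (c : Composition n) :
    N c.length * ∏ i, N (c.blocksFun i) ≤ circ N n := by
  rcases Nat.eq_zero_or_pos n with rfl | hn
  · have hlen : c.length = 0 := Nat.le_zero.1 c.length_le
    have : IsEmpty (Fin c.length) := by rw [hlen]; infer_instance
    simp [circ, hlen, hN0]
  · rw [circ, if_neg hn.ne']
    exact Finset.le_sup' (fun c : Composition n => N c.length * ∏ i, N (c.blocksFun i))
      (Finset.mem_univ c)

theorem FaaDiBruno.compositionClosed {M : ℕ → ℝ} (hM : ∀ j, 0 < M j) (hM0 : M 0 = 1)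
    (h : FaaDiBruno M) (α : ℝ) : CompositionClosed M α := by
  intro f hf U hU hfU g hg
  obtain ⟨A, -, B, hB, hAB⟩ := h
  refine comp_mem_ultraClass hM hf hU hfU hg.1 (Q := check M) (fun j => (check_pos hM j).le) ?_
    (A := A) (zero_lt_one.trans_le hB) fun n c => ?_
  · obtain ⟨h, hh, C, hC⟩ := hg.2 _ (isCompact_closure_image_of_mem_ultraClass hf) hfU
    refine ⟨h, hh, C, fun z hz j => ?_⟩
    have hj : (0 : ℝ) < j.factorial := by exact_mod_cast j.factorial_pos
    rw [norm_div, Complex.norm_natCast, div_le_iff₀ hj]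
    refine (hC z hz j).trans (le_of_eq ?_)
    rw [check]; field_simp
  · exact (le_circ (by simp [check, hM0]) c).trans (hAB n)

/-- Derivation closedness lowers each index in `M̌_{j_1} ⋯ M̌_{j_ℓ}` by one, which makes room for
the factor `M̌_ℓ`; then (rai) applies to `ℓ + (j_1 - 1) + ⋯ + (j_ℓ - 1) = k`. -/
theorem RootAlmostIncreasing.faaDiBruno {M : ℕ → ℝ} (hM : ∀ j, 0 < M j)
    (hM0 : M 0 = 1) (h : RootAlmostIncreasing M) (hdc : DerivationClosed M) : FaaDiBruno M := by
  obtain ⟨C, hC, hprod⟩ := h.exists_prod_le hM hM0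
  obtain ⟨D, hD, hDM⟩ := hdc
  have hcheck0 : check M 0 = 1 := by simp [check, hM0]
  have hstep : ∀ j, 1 ≤ j → check M j ≤ D ^ j * check M (j - 1) := by
    intro j hj
    obtain ⟨i, rfl⟩ : ∃ i, j = i + 1 := ⟨j - 1, by omega⟩
    rw [Nat.add_sub_cancel, check, check, ← mul_div_assoc]
    have : (0 : ℝ) < i.factorial := by exact_mod_cast i.factorial_pos
    refine div_le_div₀ ?_ (hDM i) this ?_
    · have := hM i; positivity
    · exact_mod_cast Nat.factorial_le (Nat.le_succ i)
  refine ⟨1, le_rfl, max 1 (D * C), le_max_left _ _, fun k => ?_⟩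
  rw [one_mul]
  rcases Nat.eq_zero_or_pos k with rfl | hk
  · simp [circ, hcheck0]
  rw [circ, if_neg hk.ne', Finset.sup'_le_iff]
  intro c _
  have hsum : ∑ i : Option (Fin c.length), (i.elim c.length fun i => c.blocksFun i - 1) = k := by
    rw [Fintype.sum_option]
    simp only [Option.elim]
    have h1 : ∑ i, c.blocksFun i = ∑ i, ((c.blocksFun i - 1) + 1) :=
      Finset.sum_congr rfl fun i _ => (Nat.sub_add_cancel (c.one_le_blocksFun i)).symm
    rw [c.sum_blocksFun, Finset.sum_add_distrib] at h1
    simp at h1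
    omega
  have h1 := hprod _ Finset.univ _ k hsum
  rw [Fintype.prod_option] at h1
  simp only [Option.elim] at h1
  have h2 : ∏ i, check M (c.blocksFun i) ≤ D ^ k * ∏ i, check M (c.blocksFun i - 1) := by
    calc _ ≤ ∏ i, (D ^ c.blocksFun i * check M (c.blocksFun i - 1)) :=
          Finset.prod_le_prod (fun i _ => (check_pos hM _).le) fun i _ =>
            hstep _ (c.one_le_blocksFun i)
      _ = _ := by rw [Finset.prod_mul_distrib, Finset.prod_pow_eq_pow_sum, c.sum_blocksFun]
  have hD0 : 0 < D := by linarith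
  have hck := check_pos hM k
  calc check M c.length * ∏ i, check M (c.blocksFun i)
      ≤ check M c.length * (D ^ k * ∏ i, check M (c.blocksFun i - 1)) :=
        mul_le_mul_of_nonneg_left h2 (check_pos hM _).le
    _ = D ^ k * (check M c.length * ∏ i, check M (c.blocksFun i - 1)) := by ring
    _ ≤ D ^ k * (C ^ k * check M k) := mul_le_mul_of_nonneg_left h1 (by positivity)
    _ = (D * C) ^ k * check M k := by ring
    _ ≤ _ := by
        gcongr
        exact le_max_right _ _

/-! ### A Laplace transform of Gevrey growth, holomorphic in a wide sector -/

/-- The integrand, in the logarithmic variable `w = log t`, of the Laplace-type integral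
`∫ t ^ (a - 1) exp (-t - z t ^ β) dt` at the point `z = exp ζ`. -/
noncomputable def laplaceKernel (a β : ℝ) (ζ w : ℂ) : ℂ :=
  Complex.exp (a * w - Complex.exp w - Complex.exp (ζ + β * w))

/-- The integral of `laplaceKernel` over the horizontal line through `s`. In the variable
`t = exp w` this is the integral over the ray of direction `im s`. -/
noncomputable def laplaceLine (a β : ℝ) (ζ s : ℂ) : ℂ :=
  ∫ τ : ℝ, laplaceKernel a β ζ (s + τ)

theorem mul_sub_mul_exp_le {x c : ℝ} (hx : 0 < x) (hc : 0 < c) (τ : ℝ) :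
    x * τ - c * Real.exp τ ≤ x * Real.log (x / c) - x := by
  have h1 := Real.add_one_le_exp (τ - Real.log (x / c))
  rw [Real.exp_sub, Real.exp_log (by positivity)] at h1
  have h2 : x * (τ - Real.log (x / c) + 1) ≤ x * (Real.exp τ / (x / c)) :=
    mul_le_mul_of_nonneg_left h1 hx.le
  have h3 : x * (Real.exp τ / (x / c)) = c * Real.exp τ := by field_simp
  linarith

theorem integrable_exp_mul_sub_mul_exp {a δ : ℝ} (ha : 0 < a) (hδ : 0 < δ) :
    MeasureTheory.Integrable (fun τ : ℝ => Real.exp (a * τ - δ * Real.exp τ)) := by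
  have hcont : Continuous (fun τ : ℝ => Real.exp (a * τ - δ * Real.exp τ)) := by fun_prop
  rw [← MeasureTheory.integrableOn_univ, ← Set.Iic_union_Ioi (a := (0 : ℝ))]
  refine MeasureTheory.IntegrableOn.union ?_ ?_
  · refine MeasureTheory.Integrable.mono' (integrableOn_exp_mul_Iic ha 0)
      hcont.aestronglyMeasurable (Eventually.of_forall fun τ => ?_)
    rw [Real.norm_of_nonneg (Real.exp_pos _).le]
    exact Real.exp_le_exp.2 (by have := Real.exp_pos τ; nlinarith)
  · refine MeasureTheory.Integrable.mono' ((integrableOn_exp_mul_Ioi (a := -1) (by norm_num)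
      0).const_mul (Real.exp ((a + 1) * Real.log ((a + 1) / δ) - (a + 1))))
      hcont.aestronglyMeasurable (Eventually.of_forall fun τ => ?_)
    rw [Real.norm_of_nonneg (Real.exp_pos _).le, ← Real.exp_add]
    refine Real.exp_le_exp.2 ?_
    have := mul_sub_mul_exp_le (x := a + 1) (by linarith) hδ τ
    linarith

theorem norm_laplaceKernel (a β : ℝ) (ζ s : ℂ) (τ : ℝ) :
    ‖laplaceKernel a β ζ (s + τ)‖ = Real.exp (a * (s.re + τ) - Real.exp τ * (Complex.exp s).re
      - Real.exp (β * τ) * (Complex.exp (ζ + β * s)).re) := by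
  have h1 : Complex.exp (s + τ) = (Real.exp τ : ℂ) * Complex.exp s := by
    rw [Complex.exp_add, Complex.ofReal_exp, mul_comm]
  have h2 : Complex.exp (ζ + β * (s + τ)) = (Real.exp (β * τ) : ℂ) * Complex.exp (ζ + β * s) := by
    rw [Complex.ofReal_exp, ← Complex.exp_add]; push_cast; ring_nf
  rw [laplaceKernel, Complex.norm_exp, h1, h2]
  simp only [Complex.sub_re, Complex.re_ofReal_mul, Complex.add_re, Complex.ofReal_re]

theorem norm_laplaceKernel_le {a β δ : ℝ} {ζ s : ℂ} (hs : δ ≤ (Complex.exp s).re)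
    (hζ : 0 ≤ (Complex.exp (ζ + β * s)).re) (τ : ℝ) :
    ‖laplaceKernel a β ζ (s + τ)‖ ≤
      Real.exp (a * s.re) * Real.exp (a * τ - δ * Real.exp τ) := by
  rw [norm_laplaceKernel, ← Real.exp_add]
  refine Real.exp_le_exp.2 ?_
  have h1 := mul_le_mul_of_nonneg_left hs (Real.exp_pos τ).le
  have h2 := mul_nonneg (Real.exp_pos (β * τ)).le hζ
  nlinarith

theorem continuous_laplaceKernel (a β : ℝ) (ζ s : ℂ) :
    Continuous fun τ : ℝ => laplaceKernel a β ζ (s + τ) := by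
  unfold laplaceKernel; fun_prop

theorem integrable_laplaceKernel {a β : ℝ} (ha : 0 < a) {ζ s : ℂ} (hs : 0 < (Complex.exp s).re)
    (hζ : 0 ≤ (Complex.exp (ζ + β * s)).re) :
    MeasureTheory.Integrable fun τ : ℝ => laplaceKernel a β ζ (s + τ) :=
  ((integrable_exp_mul_sub_mul_exp ha hs).const_mul (Real.exp (a * s.re))).mono'
    (continuous_laplaceKernel a β ζ s).aestronglyMeasurable
    (Eventually.of_forall fun τ => norm_laplaceKernel_le le_rfl hζ τ)

theorem exp_mul_laplaceKernel (a b β : ℝ) (ζ w : ℂ) :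
    Complex.exp (b * w) * laplaceKernel a β ζ w = laplaceKernel (a + b) β ζ w := by
  rw [laplaceKernel, laplaceKernel, ← Complex.exp_add]; push_cast; ring_nf

theorem hasDerivAt_laplaceKernel_left (a β : ℝ) (ζ w : ℂ) :
    HasDerivAt (fun ζ => laplaceKernel a β ζ w)
      (-Complex.exp ζ * laplaceKernel (a + β) β ζ w) ζ := by
  have h1 : HasDerivAt (fun ζ : ℂ => (a : ℂ) * w - Complex.exp w - Complex.exp (ζ + β * w))
      (-(Complex.exp (ζ + β * w) * 1)) ζ := by
    simpa using (((hasDerivAt_id ζ).add_const (β * w)).cexp).const_sub (a * w - Complex.exp w)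
  refine h1.cexp.congr_deriv ?_
  rw [← exp_mul_laplaceKernel, laplaceKernel, Complex.exp_add ζ]
  ring

theorem hasDerivAt_laplaceKernel_right (a β : ℝ) (ζ w : ℂ) :
    HasDerivAt (fun w => laplaceKernel a β ζ w)
      (a * laplaceKernel a β ζ w - laplaceKernel (a + 1) β ζ w -
        β * Complex.exp ζ * laplaceKernel (a + β) β ζ w) w := by
  have h1 : HasDerivAt (fun w : ℂ => (a : ℂ) * w - Complex.exp w - Complex.exp (ζ + β * w))
      (a * 1 - Complex.exp w - Complex.exp (ζ + β * w) * (β * 1)) w :=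
    (((hasDerivAt_id w).const_mul (a : ℂ)).sub (Complex.hasDerivAt_exp w)).sub
      (((hasDerivAt_id w).const_mul (β : ℂ)).const_add ζ).cexp
  refine h1.cexp.congr_deriv ?_
  rw [← exp_mul_laplaceKernel a 1, ← exp_mul_laplaceKernel a β, laplaceKernel, Complex.exp_add ζ]
  push_cast
  ring_nf

theorem hasDerivAt_laplaceLine_left {a β : ℝ} (ha : 0 < a) (hβ : 0 < β) {ζ₀ s : ℂ}
    (hs : 0 < (Complex.exp s).re) (hζ : 0 < (Complex.exp (ζ₀ + β * s)).re) :
    HasDerivAt (fun ζ => laplaceLine a β ζ s)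
      (-Complex.exp ζ₀ * laplaceLine (a + β) β ζ₀ s) ζ₀ := by
  set R := ‖Complex.exp ζ₀‖ + 1
  have hnhds : {ζ : ℂ | 0 < (Complex.exp (ζ + β * s)).re ∧ ‖Complex.exp ζ‖ < R} ∈ 𝓝 ζ₀ := by
    have h1 : Continuous fun ζ : ℂ => (Complex.exp (ζ + β * s)).re := by fun_prop
    have h2 : Continuous fun ζ : ℂ => ‖Complex.exp ζ‖ := by fun_prop
    refine IsOpen.mem_nhds (IsOpen.inter (isOpen_lt continuous_const h1)
      (isOpen_lt h2 continuous_const)) ⟨hζ, ?_⟩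
    change ‖Complex.exp ζ₀‖ < ‖Complex.exp ζ₀‖ + 1
    linarith
  have h := hasDerivAt_integral_of_dominated_loc_of_deriv_le (μ := MeasureTheory.volume)
    (F := fun ζ (τ : ℝ) => laplaceKernel a β ζ (s + τ))
    (F' := fun ζ (τ : ℝ) => -Complex.exp ζ * laplaceKernel (a + β) β ζ (s + τ))
    (bound := fun τ => R * (Real.exp ((a + β) * s.re) *
      Real.exp ((a + β) * τ - (Complex.exp s).re * Real.exp τ))) hnhds
    (Eventually.of_forall fun ζ => (continuous_laplaceKernel a β ζ s).aestronglyMeasurable)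
    (integrable_laplaceKernel ha hs hζ.le)
    ((continuous_laplaceKernel (a + β) β ζ₀ s).const_mul _).aestronglyMeasurable
    (Eventually.of_forall fun τ ζ hζ' => ?_)
    (((integrable_exp_mul_sub_mul_exp (by positivity) hs).const_mul _).const_mul _)
    (Eventually.of_forall fun τ ζ _ => hasDerivAt_laplaceKernel_left a β ζ (s + τ))
  · refine h.2.congr_deriv ?_
    rw [laplaceLine, MeasureTheory.integral_const_mul]
  · rw [norm_mul, norm_neg]
    exact mul_le_mul hζ'.2.le (norm_laplaceKernel_le le_rfl hζ'.1.le τ) (norm_nonneg _)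
      (by positivity)

theorem differentiableAt_laplaceLine_right {a β : ℝ} (ha : 0 < a) (hβ : 0 < β) {ζ s₀ : ℂ}
    (hs : 0 < (Complex.exp s₀).re) (hζ : 0 < (Complex.exp (ζ + β * s₀)).re) :
    DifferentiableAt ℂ (fun s => laplaceLine a β ζ s) s₀ := by
  obtain ⟨δ, hδ0, hδ⟩ := exists_between hs
  set R := s₀.re + 1
  have hnhds : {s : ℂ | (0 < (Complex.exp (ζ + β * s)).re ∧ δ < (Complex.exp s).re) ∧ s.re < R}
      ∈ 𝓝 s₀ := by
    have h1 : Continuous fun s : ℂ => (Complex.exp (ζ + β * s)).re := by fun_prop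
    have h2 : Continuous fun s : ℂ => (Complex.exp s).re := by fun_prop
    refine IsOpen.mem_nhds (IsOpen.inter (IsOpen.inter
      (isOpen_lt continuous_const h1) (isOpen_lt continuous_const h2))
      (isOpen_lt Complex.continuous_re continuous_const)) ⟨⟨hζ, hδ⟩, ?_⟩
    change s₀.re < s₀.re + 1
    linarith
  have hB : ∀ b : ℝ, 0 < b → MeasureTheory.Integrable fun τ : ℝ =>
      Real.exp (b * R) * Real.exp (b * τ - δ * Real.exp τ) := fun b hb =>
    (integrable_exp_mul_sub_mul_exp hb hδ0).const_mul _
  have hle : ∀ b : ℝ, 0 < b → ∀ (τ : ℝ) (s : ℂ), (0 < (Complex.exp (ζ + β * s)).re ∧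
      δ < (Complex.exp s).re) ∧ s.re < R → ‖laplaceKernel b β ζ (s + τ)‖ ≤
      Real.exp (b * R) * Real.exp (b * τ - δ * Real.exp τ) := by
    intro b hb τ s hs'
    refine (norm_laplaceKernel_le hs'.1.2.le hs'.1.1.le τ).trans ?_
    have := hs'.2.le
    gcongr
  have h := hasDerivAt_integral_of_dominated_loc_of_deriv_le (μ := MeasureTheory.volume)
    (F := fun s (τ : ℝ) => laplaceKernel a β ζ (s + τ))
    (F' := fun s (τ : ℝ) => a * laplaceKernel a β ζ (s + τ) - laplaceKernel (a + 1) β ζ (s + τ) -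
        β * Complex.exp ζ * laplaceKernel (a + β) β ζ (s + τ)) hnhds
    (Eventually.of_forall fun s => (continuous_laplaceKernel a β ζ s).aestronglyMeasurable)
    (integrable_laplaceKernel ha hs hζ.le)
    ((((continuous_laplaceKernel a β ζ s₀).const_mul _).sub
      (continuous_laplaceKernel (a + 1) β ζ s₀)).sub
      ((continuous_laplaceKernel (a + β) β ζ s₀).const_mul _)).aestronglyMeasurable
    (Eventually.of_forall fun τ s hs' => ?_)
    ((((hB a ha).const_mul ‖(a : ℂ)‖).add (hB (a + 1) (by positivity))).add
      ((hB (a + β) (by positivity)).const_mul ‖β * Complex.exp ζ‖))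
    (Eventually.of_forall fun τ s _ => ?_)
  · exact h.2.differentiableAt
  · refine (norm_sub_le _ _).trans (add_le_add ((norm_sub_le _ _).trans (add_le_add ?_ ?_)) ?_)
    · rw [norm_mul]
      exact mul_le_mul_of_nonneg_left (hle a ha τ s hs') (norm_nonneg _)
    · exact hle (a + 1) (by positivity) τ s hs'
    · rw [norm_mul]
      exact mul_le_mul_of_nonneg_left (hle (a + β) (by positivity) τ s hs') (norm_nonneg _)
  · exact (hasDerivAt_laplaceKernel_right a β ζ (s + τ)).comp_add_const s (τ : ℂ)

theorem exp_re_pos_of_abs_im_lt {w : ℂ} (hw : |w.im| < Real.pi / 2) :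
    0 < (Complex.exp w).re := by
  rw [Complex.exp_re]
  exact mul_pos (Real.exp_pos _) (Real.cos_pos_of_mem_Ioo (abs_lt.1 hw))

theorem laplaceLine_add_ofReal (a β : ℝ) (ζ s : ℂ) (r : ℝ) :
    laplaceLine a β ζ (s + r) = laplaceLine a β ζ s := by
  rw [laplaceLine, laplaceLine, 
    ← MeasureTheory.integral_add_right_eq_self (fun τ : ℝ => laplaceKernel a β ζ (s + τ)) r]
  congr 1 with τ
  push_cast
  ring_nf

/-- The direction of integration may be rotated. The line integral is invariant under real
translations of `s` and holomorphic in `s`, so its derivative in `s` vanishes. -/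
theorem laplaceLine_eq_laplaceLine {a β : ℝ} (ha : 0 < a) (hβ : 0 < β) {ζ s s' : ℂ}
    (hs : |s.im| < Real.pi / 2) (hζs : |(ζ + β * s).im| < Real.pi / 2)
    (hs' : |s'.im| < Real.pi / 2) (hζs' : |(ζ + β * s').im| < Real.pi / 2) :
    laplaceLine a β ζ s = laplaceLine a β ζ s' := by
  set V : Set ℂ := {s | |s.im| < Real.pi / 2} ∩ {s | |(ζ + β * s).im| < Real.pi / 2} with hV
  have hVo : IsOpen V := by
    have h1 : Continuous fun s : ℂ => |s.im| := by fun_prop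
    have h2 : Continuous fun s : ℂ => |(ζ + β * s).im| := by fun_prop
    exact (isOpen_lt h1 continuous_const).inter (isOpen_lt h2 continuous_const)
  have hVc : Convex ℝ V := by
    intro x hx y hy p q hp hq hpq
    have key : ∀ u v : ℝ, |u| < Real.pi / 2 → |v| < Real.pi / 2 →
        |p * u + q * v| < Real.pi / 2 := by
      intro u v hu hv
      have := convex_ball (0 : ℝ) (Real.pi / 2) (x := u) (by simpa using hu) (y := v)
        (by simpa using hv) hp hq hpq
      simpa using this
    refine ⟨?_, ?_⟩
    · have := key _ _ hx.1 hy.1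
      simpa using this
    · have := key _ _ hx.2 hy.2
      have h3 : (ζ + β * (p • x + q • y)).im = p * (ζ + β * x).im + q * (ζ + β * y).im := by
        simp only [Complex.add_im, Complex.im_ofReal_mul, Complex.real_smul]
        linear_combination (-ζ.im) * hpq
      change |(ζ + β * (p • x + q • y)).im| < _
      rwa [h3]
  have hdiff : ∀ u ∈ V, DifferentiableAt ℂ (fun s => laplaceLine a β ζ s) u := fun u hu =>
    differentiableAt_laplaceLine_right ha hβ (exp_re_pos_of_abs_im_lt hu.1)
      (exp_re_pos_of_abs_im_lt hu.2)
  refine hVo.is_const_of_deriv_eq_zero (f := fun s => laplaceLine a β ζ s) hVc.isPreconnected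
    (fun u hu => (hdiff u hu).differentiableWithinAt) (fun u hu => ?_) ⟨hs, hζs⟩ ⟨hs', hζs'⟩
  have h1 : HasDerivAt (fun r : ℝ => laplaceLine a β ζ (u + r))
      (deriv (fun s => laplaceLine a β ζ s) u) 0 := by
    have h2 : HasDerivAt (fun s => laplaceLine a β ζ s)
        (deriv (fun s => laplaceLine a β ζ s) u) (u + ((0 : ℝ) : ℂ)) := by
      simpa using (hdiff u hu).hasDerivAt
    have h3 := (h2.comp_const_add u _).comp_ofReal
    exact h3
  simp only [laplaceLine_add_ofReal] at h1
  exact h1.unique (hasDerivAt_const _ _)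

/-- The direction `-κ arg z` of integration used at `z = exp ζ`, as a point of the imaginary axis.
The value `κ = (α - 1) / (α β)` makes `arg (z t ^ β) = arg z / α`, which is less than `π / 2` in
absolute value on the sector, while `|arg t| ≤ (α - 1) / β * (π / 2) < π / 2`. -/
noncomputable def laplaceDir (α β : ℝ) (ζ : ℂ) : ℂ :=
  ((-((α - 1) / (α * β) * ζ.im) : ℝ) : ℂ) * Complex.I

/-- The continuation of `∫₀^∞ t ^ (j β) exp (-t - z t ^ β) dt` to the sector of opening `α π`. -/
noncomputable def laplaceGevrey (α β : ℝ) (j : ℕ) (ζ : LogSurface) : ℂ :=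
  laplaceLine (1 + j * β) β ζ (laplaceDir α β ζ)

section laplaceGevrey

variable {α β : ℝ}

theorem laplaceDir_re (ζ : ℂ) : (laplaceDir α β ζ).re = 0 := by
  rw [laplaceDir, Complex.re_ofReal_mul, Complex.I_re, mul_zero]

theorem abs_laplaceDir_im_le (hα : 1 < α) (hβ : α - 1 < β) {ζ : ℂ} (hζ : ζ ∈ sector α) :
    |(laplaceDir α β ζ).im| ≤ (α - 1) / β * (Real.pi / 2) := by
  have hβ0 : 0 < β := by linarith
  have h1 : |ζ.im| < α * Real.pi / 2 := hζ
  have hc : 0 ≤ (α - 1) / (α * β) := div_nonneg (by linarith) (by positivity)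
  simp only [laplaceDir, Complex.mul_im, Complex.ofReal_re, Complex.ofReal_im, Complex.I_re,
    Complex.I_im, mul_one, mul_zero, add_zero]
  rw [abs_neg, abs_mul, abs_of_nonneg hc]
  calc _ ≤ (α - 1) / (α * β) * (α * Real.pi / 2) := mul_le_mul_of_nonneg_left h1.le hc
    _ = _ := by field_simp

theorem mul_pi_div_two_lt (hα : 1 < α) (hβ : α - 1 < β) :
    (α - 1) / β * (Real.pi / 2) < Real.pi / 2 := by
  have hβ0 : 0 < β := by linarith
  have h1 : (α - 1) / β < 1 := (div_lt_one hβ0).2 hβ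
  nlinarith [Real.pi_pos]

theorem abs_laplaceDir_im_lt (hα : 1 < α) (hβ : α - 1 < β) {ζ : ℂ} (hζ : ζ ∈ sector α) :
    |(laplaceDir α β ζ).im| < Real.pi / 2 :=
  (abs_laplaceDir_im_le hα hβ hζ).trans_lt (mul_pi_div_two_lt hα hβ)

theorem abs_add_mul_laplaceDir_im_lt (hα : 1 < α) (hβ : α - 1 < β) {ζ : ℂ}
    (hζ : ζ ∈ sector α) : |(ζ + β * laplaceDir α β ζ).im| < Real.pi / 2 := by
  have hβ0 : 0 < β := by linarith
  have h1 : |ζ.im| < α * Real.pi / 2 := hζ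
  have h2 : (ζ + β * laplaceDir α β ζ).im = ζ.im / α := by
    simp only [laplaceDir, Complex.add_im, Complex.im_ofReal_mul, Complex.I_im, mul_one]
    field_simp
    ring
  rw [h2, abs_div, abs_of_pos (by linarith : 0 < α), div_lt_iff₀ (by linarith)]
  linarith

theorem hasDerivAt_laplaceGevrey (hα : 1 < α) (hβ : α - 1 < β) (j : ℕ) {ζ : LogSurface}
    (hζ : ζ ∈ sector α) :
    HasDerivAt (laplaceGevrey α β j) (-Complex.exp ζ * laplaceGevrey α β (j + 1) ζ) ζ := by
  have hβ0 : 0 < β := by linarith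
  have ha : 0 < 1 + (j : ℝ) * β := by positivity
  have h1 := hasDerivAt_laplaceLine_left ha hβ0
    (exp_re_pos_of_abs_im_lt (abs_laplaceDir_im_lt hα hβ hζ))
    (exp_re_pos_of_abs_im_lt (abs_add_mul_laplaceDir_im_lt hα hβ hζ))
  have h2 : laplaceGevrey α β j =ᶠ[𝓝 ζ]
      fun w => laplaceLine (1 + j * β) β w (laplaceDir α β ζ) := by
    have h3 : ∀ᶠ w in 𝓝 ζ, |(w + β * laplaceDir α β ζ).im| < Real.pi / 2 := by
      have : ContinuousAt (fun w : ℂ => |(w + β * laplaceDir α β ζ).im|) ζ := by fun_prop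
      exact this.eventually (gt_mem_nhds (abs_add_mul_laplaceDir_im_lt hα hβ hζ))
    filter_upwards [h3, (isOpen_sector α).mem_nhds hζ] with w hw hwα
    exact laplaceLine_eq_laplaceLine ha hβ0 (abs_laplaceDir_im_lt hα hβ hwα)
      (abs_add_mul_laplaceDir_im_lt hα hβ hwα) (abs_laplaceDir_im_lt hα hβ hζ) hw
  refine (h1.congr_of_eventuallyEq h2).congr_deriv ?_
  rw [laplaceGevrey]
  push_cast
  ring_nf

theorem gevreyBar_eq_exp {j : ℕ} (hj : 0 < j) :
    gevreyBar β j = Real.exp (j * β * Real.log j) := by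
  rw [gevreyBar, Real.rpow_def_of_pos (by exact_mod_cast hj), mul_comm]

theorem gevreyBar_pos (j : ℕ) : 0 < gevreyBar β j := by
  rcases Nat.eq_zero_or_pos j with rfl | hj
  · simp [gevreyBar]
  · rw [gevreyBar_eq_exp hj]; exact Real.exp_pos _

theorem exists_norm_laplaceGevrey_le (hα : 1 < α) (hβ : α - 1 < β) :
    ∃ C > (0 : ℝ), ∃ K > (0 : ℝ), ∀ (j : ℕ), ∀ ζ ∈ sector α,
      ‖laplaceGevrey α β j ζ‖ ≤ C * (K ^ j * gevreyBar β j) := by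
  have hβ0 : 0 < β := by linarith
  set φ := (α - 1) / β * (Real.pi / 2) with hφ
  have hφ0 : 0 ≤ φ := mul_nonneg (div_nonneg (by linarith) hβ0.le) (by positivity)
  have hφ1 : φ < Real.pi / 2 := mul_pi_div_two_lt hα hβ
  set δ := Real.cos φ
  have hδ : 0 < δ := Real.cos_pos_of_mem_Ioo ⟨by linarith, hφ1⟩
  have hint := integrable_exp_mul_sub_mul_exp one_pos (half_pos hδ)
  set I := ∫ τ : ℝ, Real.exp (1 * τ - δ / 2 * Real.exp τ) with hI
  have hI0 : 0 ≤ I := MeasureTheory.integral_nonneg fun τ => (Real.exp_pos _).le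
  set K := Real.exp (β * Real.log (2 * β / δ)) with hK
  refine ⟨I + 1, by positivity, K, Real.exp_pos _, fun j ζ hζ => ?_⟩
  have hs : δ ≤ (Complex.exp (laplaceDir α β ζ)).re := by
    rw [Complex.exp_re, ← Real.cos_abs]
    rw [laplaceDir_re, Real.exp_zero, one_mul]
    exact Real.cos_le_cos_of_nonneg_of_le_pi (abs_nonneg _) (by linarith [Real.pi_pos])
      (abs_laplaceDir_im_le hα hβ hζ)
  have hsup : ∀ τ : ℝ, j * β * τ - δ / 2 * Real.exp τ ≤
      Real.log (K ^ j * gevreyBar β j) := by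
    intro τ
    rw [Real.log_mul (by positivity) (gevreyBar_pos j).ne', Real.log_pow, hK, Real.log_exp]
    rcases Nat.eq_zero_or_pos j with rfl | hj
    · have : 0 < δ / 2 * Real.exp τ := by positivity
      simp [gevreyBar]
      linarith
    · have hj' : (0 : ℝ) < j := by exact_mod_cast hj
      have h1 := mul_sub_mul_exp_le (x := j * β) (by positivity) (half_pos hδ) τ
      have h2 : Real.log (j * β / (δ / 2)) = Real.log j + Real.log (2 * β / δ) := by
        rw [← Real.log_mul (by positivity) (by positivity)]
        congr 1; field_simp
      rw [h2] at h1
      rw [gevreyBar_eq_exp hj, Real.log_exp]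
      have : 0 < j * β := by positivity
      linarith
  have hpt : ∀ τ : ℝ, ‖laplaceKernel (1 + j * β) β ζ (laplaceDir α β ζ + τ)‖ ≤
      K ^ j * gevreyBar β j * Real.exp (1 * τ - δ / 2 * Real.exp τ) := by
    intro τ
    refine (norm_laplaceKernel_le hs
      (exp_re_pos_of_abs_im_lt (abs_add_mul_laplaceDir_im_lt hα hβ hζ)).le τ).trans ?_
    have h2 : 0 < K ^ j * gevreyBar β j := mul_pos (by positivity) (gevreyBar_pos j)
    rw [laplaceDir_re, mul_zero, Real.exp_zero, one_mul]
    conv_rhs => rw [← Real.exp_log h2, ← Real.exp_add]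
    exact Real.exp_le_exp.2 (by linarith [hsup τ])
  calc ‖laplaceGevrey α β j ζ‖
      ≤ ∫ τ : ℝ, K ^ j * gevreyBar β j * Real.exp (1 * τ - δ / 2 * Real.exp τ) :=
        MeasureTheory.norm_integral_le_of_norm_le (hint.const_mul _) (Eventually.of_forall hpt)
    _ = I * (K ^ j * gevreyBar β j) := by rw [MeasureTheory.integral_const_mul, mul_comm]
    _ ≤ _ := by
        have := gevreyBar_pos (β := β) j
        exact mul_le_mul_of_nonneg_right (by linarith) (by positivity)

theorem laplaceGevrey_ofReal (j : ℕ) (x : ℝ) :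
    laplaceGevrey α β j x = ((∫ τ : ℝ, Real.exp ((1 + j * β) * τ - Real.exp τ -
      Real.exp (x + β * τ)) : ℝ) : ℂ) := by
  rw [laplaceGevrey, laplaceLine, ← integral_complex_ofReal]
  congr 1 with τ
  simp [laplaceKernel, laplaceDir]

theorem exists_le_laplaceGevrey (hβ : 0 < β) :
    ∃ c > (0 : ℝ), ∃ k > (0 : ℝ), ∀ j : ℕ, ∃ X : ℝ, ∀ x ≤ X,
      c * (k ^ j * gevreyBar β j) ≤ (laplaceGevrey α β j x).re := by
  refine ⟨Real.exp (-Real.exp 1 - 1), Real.exp_pos _, Real.exp (-Real.exp 1), Real.exp_pos _,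
    fun j => ⟨-(β * (Real.log (j + 1) + 1)), fun x hx => ?_⟩⟩
  rw [laplaceGevrey_ofReal, Complex.ofReal_re]
  set t : ℝ := j + 1 with ht
  have ht0 : 1 ≤ t := by simp [ht]
  have hlog : 0 ≤ Real.log t := Real.log_nonneg ht0
  have hint : MeasureTheory.Integrable fun τ : ℝ =>
      Real.exp ((1 + j * β) * τ - Real.exp τ - Real.exp (x + β * τ)) := by
    refine (integrable_exp_mul_sub_mul_exp (a := 1 + j * β) (by positivity) one_pos).mono'
      (by fun_prop) (Eventually.of_forall fun τ => ?_)
    rw [Real.norm_of_nonneg (Real.exp_pos _).le]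
    exact Real.exp_le_exp.2 (by linarith [Real.exp_pos (x + β * τ)])
  -- the mass of the integrand on the interval `1 ≤ t / (j + 1) ≤ e` already suffices
  have hge : ∀ τ ∈ Set.Icc (Real.log t) (Real.log t + 1),
      Real.exp (-Real.exp 1 - 1) * (Real.exp (-Real.exp 1) ^ j * gevreyBar β j) ≤
      Real.exp ((1 + j * β) * τ - Real.exp τ - Real.exp (x + β * τ)) := by
    intro τ hτ
    have h1 : Real.exp τ ≤ t * Real.exp 1 := by
      calc Real.exp τ ≤ Real.exp (Real.log t + 1) := Real.exp_le_exp.2 hτ.2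
        _ = _ := by rw [Real.exp_add, Real.exp_log (by linarith)]
    have h2 : Real.exp (x + β * τ) ≤ 1 := by
      refine Real.exp_le_one_iff.2 ?_
      have := mul_le_mul_of_nonneg_left hτ.2 hβ.le
      linarith
    have h3 : Real.log (gevreyBar β j) ≤ j * β * Real.log t := by
      rcases Nat.eq_zero_or_pos j with rfl | hj
      · simp [gevreyBar]
      · rw [gevreyBar_eq_exp hj, Real.log_exp]
        have hj' : (0 : ℝ) < j := by exact_mod_cast hj
        exact mul_le_mul_of_nonneg_left (Real.log_le_log hj' (by linarith)) (by positivity)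
    have h4 : j * β * Real.log t ≤ (1 + j * β) * τ := by
      have : (0 : ℝ) ≤ j * β := by positivity
      nlinarith [hτ.1]
    rw [← Real.exp_nat_mul, ← Real.exp_log (gevreyBar_pos (β := β) j), ← Real.exp_add,
      ← Real.exp_add]
    refine Real.exp_le_exp.2 ?_
    rw [ht] at h1
    linarith
  have hvol : (MeasureTheory.volume : MeasureTheory.Measure ℝ).real
      (Set.Icc (Real.log t) (Real.log t + 1)) = 1 := by simp
  calc _ = ∫ _ in Set.Icc (Real.log t) (Real.log t + 1),
        Real.exp (-Real.exp 1 - 1) * (Real.exp (-Real.exp 1) ^ j * gevreyBar β j) := by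
        rw [MeasureTheory.setIntegral_const, hvol, one_smul]
    _ ≤ ∫ τ in Set.Icc (Real.log t) (Real.log t + 1),
        Real.exp ((1 + j * β) * τ - Real.exp τ - Real.exp (x + β * τ)) :=
        MeasureTheory.setIntegral_mono_on continuous_const.integrableOn_Icc hint.integrableOn measurableSet_Icc hge
    _ ≤ _ := MeasureTheory.setIntegral_le_integral hint
        (Eventually.of_forall fun τ => (Real.exp_pos _).le)

end laplaceGevrey

/-! ### A function of the class with large derivatives at the vertex -/

theorem gevreyBar_neg (β : ℝ) (j : ℕ) : gevreyBar (-β) j = (gevreyBar β j)⁻¹ := by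
  rw [gevreyBar, gevreyBar, mul_neg, Real.rpow_neg (Nat.cast_nonneg j)]

/-- A log-convex sequence lies above its tangents, in the logarithmic scale. -/
theorem LogConvex.mul_ratio_pow_le {L : ℕ → ℝ} (hL : LogConvex L) (hpos : ∀ j, 0 < L j)
    (k j : ℕ) : L k * (L (k + 1) / L k) ^ j ≤ L j * (L (k + 1) / L k) ^ k := by
  set r : ℕ → ℝ := fun k => L (k + 1) / L k with hr
  have hr0 : ∀ k, 0 < r k := fun k => div_pos (hpos _) (hpos _)
  have hmono : Monotone r := by
    refine monotone_nat_of_le_succ fun i => ?_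
    rw [hr]
    dsimp only
    rw [div_le_div_iff₀ (hpos _) (hpos _)]
    nlinarith [hL i]
  have hstep : ∀ i, L (i + 1) = L i * r i := fun i => by
    rw [hr]; have := hpos i; field_simp
  change L k * r k ^ j ≤ L j * r k ^ k
  rcases le_total k j with h | h
  · induction j, h using Nat.le_induction with
    | base => exact le_rfl
    | succ j hj ih =>
      have h1 := mul_le_mul ih (hmono hj) (hr0 k).le
        (mul_nonneg (hpos j).le (pow_nonneg (hr0 k).le _))
      rw [hstep j, pow_succ]
      linarith
  · induction h using Nat.decreasingInduction with
    | self => exact le_rfl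
    | of_succ j hj ih =>
      have h1 : L (j + 1) ≤ L j * r k := by
        rw [hstep]; exact mul_le_mul_of_nonneg_left (hmono (by omega)) (hpos j).le
      have h2 : L k * r k ^ j * r k ≤ L j * r k ^ k * r k := by
        calc _ = L k * r k ^ (j + 1) := by rw [pow_succ]; ring
          _ ≤ L (j + 1) * r k ^ k := ih
          _ ≤ L j * r k * r k ^ k := mul_le_mul_of_nonneg_right h1 (pow_nonneg (hr0 k).le _)
          _ = _ := by ring
      exact le_of_mul_le_mul_right h2 (hr0 k)

theorem add_ofReal_mem_sector {α : ℝ} {ζ : ℂ} (hζ : ζ ∈ sector α) (x : ℝ) :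
    ζ + (x : ℂ) ∈ sector α := by
  simpa [sector, LogSurface.arg] using hζ

theorem ofReal_mem_sector {α : ℝ} (hα : 0 < α) (x : ℝ) : (x : ℂ) ∈ sector α := by
  simpa [sector, LogSurface.arg] using by positivity

theorem zderiv_iterate_eqOn {α : ℝ} {S : ℕ → LogSurface → ℂ}
    (hS : ∀ j, ∀ ζ ∈ sector α, zderiv (S j) ζ = -S (j + 1) ζ) (j : ℕ) :
    Set.EqOn (zderiv^[j] (S 0)) (fun ζ => (-1) ^ j * S j ζ) (sector α) := by
  induction j with
  | zero => intro ζ _; simp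
  | succ j ih =>
    intro ζ hζ
    have h1 := (ih.eventuallyEq_of_mem ((isOpen_sector α).mem_nhds hζ)).deriv_eq
    have h2 := hS j ζ hζ
    rw [zderiv] at h2
    rw [Function.iterate_succ_apply', zderiv, h1, deriv_const_mul_field']
    dsimp only
    rw [pow_succ]
    linear_combination (-1) ^ j * h2

/-- The superposition `∑ 2 ^ (-k) L_k λ_k ^ (-k) E (λ_k z)`, with `λ_k = L_{k+1} / L_k` and `E` the
Laplace transform of Gevrey growth, is completely monotone on the positive half-line, lies in the
class and its derivatives near the vertex are as large as the class allows. -/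
theorem exists_completelyMonotone_mem_ultraClass {M L : ℕ → ℝ} {α β : ℝ}
    (hα : 1 < α) (hβ : α - 1 < β) (hLpos : ∀ j, 0 < L j) (hL : LogConvex L)
    (hML : Preceq M fun j => L j * gevreyBar β j) (hLM : Preceq (fun j => L j * gevreyBar β j) M) :
    ∃ f ∈ ultraClass M α,
      (∀ (j : ℕ) (x : ℝ), ∃ r : ℝ, 0 ≤ r ∧ (-1) ^ j * zderiv^[j] f x = r) ∧
      ∃ a > (0 : ℝ), ∃ b > (0 : ℝ), ∀ j : ℕ, ∀ᶠ x : ℝ in atBot,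
        a * (b ^ j * M j) ≤ ((-1) ^ j * zderiv^[j] f x).re := by
  have hβ0 : 0 < β := by linarith
  obtain ⟨C, hC, K, hK, hCK⟩ := exists_norm_laplaceGevrey_le hα hβ
  obtain ⟨c, hc, k₀, hk₀, hck⟩ := exists_le_laplaceGevrey (α := α) hβ0
  obtain ⟨A, hA, B, hB, hAB⟩ := hML
  obtain ⟨A', hA', B', hB', hAB'⟩ := hLM
  set r : ℕ → ℝ := fun k => L (k + 1) / L k
  have hr0 : ∀ k, 0 < r k := fun k => div_pos (hLpos _) (hLpos _)
  set u : ℕ → ℕ → ℝ := fun j k => (1 / 2) ^ k * (L k / r k ^ k) * r k ^ j with hu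
  have hu0 : ∀ j k, 0 < u j k := fun j k => by
    have := hLpos k; have := hr0 k; rw [hu]; positivity
  have hule : ∀ j k, u j k ≤ (1 / 2) ^ k * L j := by
    intro j k
    have h1 := hL.mul_ratio_pow_le hLpos k j
    have := hr0 k
    rw [hu]; dsimp only
    rw [mul_assoc]
    refine mul_le_mul_of_nonneg_left ?_ (by positivity)
    rw [div_mul_eq_mul_div, div_le_iff₀ (by positivity)]
    exact h1
  have huj : ∀ j, u j j = (1 / 2) ^ j * L j := by
    intro j
    have := hr0 j
    rw [hu]; field_simp
  have husucc : ∀ j k, u (j + 1) k = u j k * r k := fun j k => by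
    rw [hu]; dsimp only; rw [pow_succ]; ring
  set T : ℕ → ℕ → ℂ → ℂ := fun j k ζ => (u j k : ℂ) * laplaceGevrey α β j (ζ + Real.log (r k))
    with hT
  set S : ℕ → LogSurface → ℂ := fun j ζ => ∑' k, T j k ζ with hS
  set v : ℕ → ℕ → ℝ := fun j k => (1 / 2) ^ k * (L j * (C * (K ^ j * gevreyBar β j))) with hv
  have hv_sum : ∀ j, HasSum (v j) (2 * (L j * (C * (K ^ j * gevreyBar β j)))) := fun j =>
    hasSum_geometric_two.mul_right _
  have hTv : ∀ j k, ∀ ζ ∈ sector α, ‖T j k ζ‖ ≤ v j k := by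
    intro j k ζ hζ
    rw [hT, hv]; dsimp only
    rw [norm_mul, Complex.norm_real, Real.norm_of_nonneg (hu0 j k).le, ← mul_assoc]
    exact mul_le_mul (hule j k) (hCK j _ (add_ofReal_mem_sector hζ _)) (norm_nonneg _)
      (by have := hLpos j; positivity)
  have hTd : ∀ j k, ∀ ζ ∈ sector α,
      HasDerivAt (T j k) (-Complex.exp ζ * T (j + 1) k ζ) ζ := by
    intro j k ζ hζ
    have h1 := ((hasDerivAt_laplaceGevrey hα hβ j
      (add_ofReal_mem_sector hζ (Real.log (r k)))).comp_add_const ζ _).const_mul (u j k : ℂ)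
    refine h1.congr_deriv ?_
    rw [hT]; dsimp only
    rw [husucc, Complex.exp_add, ← Complex.ofReal_exp, Real.exp_log (hr0 k)]
    push_cast
    ring
  have hTdiff : ∀ j k, DifferentiableOn ℂ (T j k) (sector α) := fun j k ζ hζ =>
    (hTd j k ζ hζ).differentiableAt.differentiableWithinAt
  have hSz : ∀ j, ∀ ζ ∈ sector α, zderiv (S j) ζ = -S (j + 1) ζ := by
    intro j ζ hζ
    have h1 := Complex.hasSum_deriv_of_summable_norm (hv_sum j).summable (hTdiff j)
      (isOpen_sector α) (hTv j) hζ
    have h2 : ∀ k, deriv (T j k) ζ = -Complex.exp ζ * T (j + 1) k ζ := fun k =>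
      (hTd j k ζ hζ).deriv
    simp only [h2] at h1
    rw [zderiv, ← h1.tsum_eq, tsum_mul_left, Complex.exp_neg]
    have := Complex.exp_ne_zero ζ
    field_simp
    rfl
  have hSiter := zderiv_iterate_eqOn hSz
  have hSle : ∀ j, ∀ ζ ∈ sector α, ‖S j ζ‖ ≤ 2 * (L j * (C * (K ^ j * gevreyBar β j))) :=
    fun j ζ hζ => tsum_of_norm_bounded (hv_sum j) fun k => hTv j k ζ hζ
  have hreal : ∀ j (x : ℝ), ∃ t : ℕ → ℝ, (∀ k, 0 ≤ t k) ∧ Summable t ∧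
      S j x = ((∑' k, t k : ℝ) : ℂ) ∧
      ∀ k, t k = u j k * (laplaceGevrey α β j ((x + Real.log (r k) : ℝ) : ℂ)).re := by
    intro j x
    have h0 : ∀ k, T j k x = ((u j k * (laplaceGevrey α β j
        ((x + Real.log (r k) : ℝ) : ℂ)).re : ℝ) : ℂ) := by
      intro k
      rw [hT]; dsimp only
      rw [← Complex.ofReal_add, laplaceGevrey_ofReal, Complex.ofReal_re,
        Complex.ofReal_mul (u j k)]
    have hx : (x : ℂ) ∈ sector α := ofReal_mem_sector (by linarith) x
    refine ⟨fun k => u j k * (laplaceGevrey α β j ((x + Real.log (r k) : ℝ) : ℂ)).re,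
      fun k => ?_, ?_, ?_, fun k => rfl⟩
    · dsimp only
      rw [laplaceGevrey_ofReal, Complex.ofReal_re]
      exact mul_nonneg (hu0 j k).le (MeasureTheory.integral_nonneg fun τ => (Real.exp_pos _).le)
    · have h1 := (hv_sum j).summable.of_norm_bounded fun k => hTv j k x hx
      simp only [h0] at h1
      exact Complex.summable_ofReal.1 h1
    · rw [hS]; dsimp only
      simp only [h0, Complex.ofReal_tsum]
  have hx0 : ∀ x : ℝ, (x : ℂ) ∈ sector α := fun x => ofReal_mem_sector (by linarith) x
  have hsign : ∀ j (x : ℝ), (-1) ^ j * zderiv^[j] (S 0) x = S j x := by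
    intro j x
    rw [hSiter j (hx0 x), ← mul_assoc, ← mul_pow]
    simp
  refine ⟨S 0, ⟨Complex.differentiableOn_tsum_of_summable_norm (hv_sum 0).summable (hTdiff 0)
    (isOpen_sector α) (hTv 0), K * B', by positivity, 2 * C * A', fun ζ hζ j => ?_⟩, ?_, ?_⟩
  · rw [hSiter j hζ, norm_mul, norm_pow, norm_neg, norm_one, one_pow, one_mul]
    calc ‖S j ζ‖ ≤ 2 * (L j * (C * (K ^ j * gevreyBar β j))) := hSle j ζ hζ
      _ = 2 * C * K ^ j * (L j * gevreyBar β j) := by ring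
      _ ≤ 2 * C * K ^ j * (A' * B' ^ j * M j) :=
          mul_le_mul_of_nonneg_left (hAB' j) (by positivity)
      _ = _ := by ring
  · intro j x
    obtain ⟨t, ht0, -, hSt, -⟩ := hreal j x
    exact ⟨∑' k, t k, tsum_nonneg ht0, by rw [hsign, hSt]⟩
  · refine ⟨c / A, by positivity, 1 / 2 * k₀ / B, by positivity, fun j => ?_⟩
    obtain ⟨X, hX⟩ := hck j
    filter_upwards [eventually_le_atBot (X - Real.log (r j))] with x hx
    obtain ⟨t, ht0, htsum, hSt, ht⟩ := hreal j x
    rw [hsign, hSt, Complex.ofReal_re]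
    -- the term of index `j` alone gives the lower bound
    refine le_trans ?_ (htsum.le_tsum j fun k _ => ht0 k)
    rw [ht, huj]
    have h1 := hX (x + Real.log (r j)) (by linarith)
    have hLj := hLpos j
    calc c / A * ((1 / 2 * k₀ / B) ^ j * M j)
        ≤ c / A * ((1 / 2 * k₀ / B) ^ j * (A * B ^ j * (L j * gevreyBar β j))) := by
          have := hAB j
          gcongr
      _ = (1 / 2) ^ j * L j * (c * (k₀ ^ j * gevreyBar β j)) := by
          rw [div_pow, mul_pow]; field_simp
      _ ≤ _ := mul_le_mul_of_nonneg_left h1 (by positivity)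

/-! ### Inverse-closed classes -/

theorem zderiv_neg (v : LogSurface → ℂ) : zderiv (fun ζ => -v ζ) = fun ζ => -zderiv v ζ := by
  funext ζ
  simp [zderiv]

theorem zderiv_iterate_const_sub (c : ℂ) (f : LogSurface → ℂ) (j : ℕ) :
    zderiv^[j + 1] (fun ζ => c - f ζ) = fun ζ => -zderiv^[j + 1] f ζ := by
  induction j with
  | zero => funext ζ; simp [zderiv]
  | succ j ih => rw [Function.iterate_succ_apply', ih, zderiv_neg,
      ← Function.iterate_succ_apply' zderiv (j + 1) f]

theorem const_sub_mem_ultraClass {M : ℕ → ℝ} (hM : ∀ j, 0 < M j) (hM0 : M 0 = 1) {α : ℝ}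
    {f : LogSurface → ℂ} (hf : f ∈ ultraClass M α) (c : ℂ) :
    (fun ζ => c - f ζ) ∈ ultraClass M α := by
  obtain ⟨hd, h, hh, C, hC⟩ := hf
  refine ⟨hd.const_sub c, h, hh, C + ‖c‖, fun ζ hζ j => ?_⟩
  have h1 := hC ζ hζ j
  have h2 : 0 < h ^ j * M j := mul_pos (by positivity) (hM j)
  cases j with
  | zero =>
    simp only [Function.iterate_zero, id_eq, pow_zero, hM0, mul_one] at h1 ⊢
    linarith [norm_sub_le c (f ζ)]
  | succ j =>
    rw [zderiv_iterate_const_sub, norm_neg]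
    nlinarith [norm_nonneg c]

theorem iteratedDeriv_one_div_const_sub (c w : ℂ) (n : ℕ) :
    iteratedDeriv n (fun w => 1 / (c - w)) w / n.factorial = ((c - w) ^ (n + 1))⁻¹ := by
  have h1 : (fun w : ℂ => 1 / (c - w)) = fun w => ((-1) * w + c)⁻¹ := by
    funext w; rw [one_div]; ring_nf
  have h2 : ((n.factorial : ℕ) : ℂ) ≠ 0 := by exact_mod_cast n.factorial_ne_zero
  rw [h1, iteratedDeriv_eq_iterate, iter_deriv_inv_linear]
  dsimp only
  have h3 : (-1 - n : ℤ) = -((n + 1 : ℕ) : ℤ) := by push_cast; ring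
  have h4 : ((-1 : ℂ) ^ n) * (-1) ^ n = 1 := by rw [← mul_pow]; simp
  rw [h3, zpow_neg, zpow_natCast, show -1 * w + c = c - w by ring]
  calc _ = ((-1) ^ n * (-1) ^ n) * ((n.factorial : ℂ) / n.factorial) * ((c - w) ^ (n + 1))⁻¹ := by
        ring
    _ = _ := by rw [h4, div_self h2, one_mul, one_mul]

/-- The Taylor coefficients of `1 / (c - f)`, up to the signs `(-1) ^ k`, are sums of nonnegative
terms if `f` is completely monotone, so each product of Taylor coefficients of `f` is controlled
by one Taylor coefficient of a function of the class. -/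
theorem InverseClosed.exists_prod_check_le {M : ℕ → ℝ} (hM : ∀ j, 0 < M j) (hM0 : M 0 = 1)
    {α : ℝ} (hα : 0 < α) (hinv : InverseClosed M α) {f : LogSurface → ℂ} (hf : f ∈ ultraClass M α)
    (hmono : ∀ (j : ℕ) (x : ℝ), ∃ r : ℝ, 0 ≤ r ∧ (-1) ^ j * zderiv^[j] f x = r)
    {a b : ℝ} (ha : 0 < a) (hb : 0 < b) (hlow : ∀ j : ℕ, ∀ᶠ x : ℝ in atBot,
      a * (b ^ j * M j) ≤ ((-1) ^ j * zderiv^[j] f x).re) :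
    ∃ C > (0 : ℝ), ∃ H > (0 : ℝ), ∀ (k : ℕ) (c : Composition k),
      ∏ i, check M (c.blocksFun i) ≤ C * H ^ k * check M k := by
  obtain ⟨C₀, hC₀⟩ : ∃ C₀ : ℝ, ∀ ζ ∈ sector α, ‖f ζ‖ ≤ C₀ := by
    obtain ⟨-, h, -, C, hC⟩ := hf
    exact ⟨_, fun ζ hζ => hC ζ hζ 0⟩
  have hC₀0 : 0 ≤ C₀ := (norm_nonneg _).trans (hC₀ _ (ofReal_mem_sector hα 0))
  set Λ := C₀ + 1 with hΛ
  have hΛ1 : 1 ≤ Λ := by linarith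
  have hu := const_sub_mem_ultraClass hM hM0 hf (Λ : ℂ)
  have hlowu : ∀ ζ ∈ sector α, 1 ≤ ‖(Λ : ℂ) - f ζ‖ := by
    intro ζ hζ
    have h1 := norm_sub_norm_le (Λ : ℂ) (f ζ)
    rw [Complex.norm_real, Real.norm_of_nonneg (by linarith)] at h1
    linarith [hC₀ ζ hζ]
  obtain ⟨-, h, hh, C, hC⟩ := hinv _ hu ⟨1, one_pos, hlowu⟩
  set D := max 1 (Λ / a) with hD
  have hD1 : 1 ≤ D := le_max_left _ _
  refine ⟨max 1 C * Λ, by positivity, D * h / b, by positivity, fun k c => ?_⟩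
  obtain ⟨x, hx⟩ := ((Finset.univ : Finset (Fin c.length)).eventually_all.2
    fun i _ => hlow (c.blocksFun i)).exists
  choose φ hφ0 hφ using fun j => hmono j x
  have hxs : (x : ℂ) ∈ sector α := ofReal_mem_sector hα x
  have hfx : f x = φ 0 := by simpa using hφ 0
  have hφC : φ 0 ≤ C₀ := by
    have := hC₀ _ hxs
    rwa [hfx, Complex.norm_real, Real.norm_of_nonneg (hφ0 0)] at this
  have hΛφ : 0 < Λ - φ 0 := by linarith
  have hk : (0 : ℝ) < k.factorial := by exact_mod_cast k.factorial_pos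
  set term : Composition k → ℝ := fun c => ((Λ - φ 0) ^ (c.length + 1))⁻¹ *
    ∏ i, (φ (c.blocksFun i) / (c.blocksFun i).factorial) with hterm
  have hterm0 : ∀ c, 0 ≤ term c := fun c => mul_nonneg (by positivity)
    (Finset.prod_nonneg fun i _ => div_nonneg (hφ0 _) (Nat.cast_nonneg _))
  have hsum : (-1) ^ k * (zderiv^[k] (fun ζ => 1 / ((Λ : ℂ) - f ζ)) x / k.factorial) =
      ((∑ c, term c : ℝ) : ℂ) := by
    have hne : (Λ : ℂ) - f x ≠ 0 := by
      intro h0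
      have := hlowu _ hxs
      rw [h0, norm_zero] at this
      linarith
    have hg : AnalyticAt ℂ (fun w : ℂ => 1 / ((Λ : ℂ) - w)) (f x) :=
      analyticAt_const.div (analyticAt_const.sub analyticAt_id) hne
    have h1 := zderiv_iterate_comp (analyticAt_of_mem_ultraClass hf hxs) hg k
    have h2 : (fun w : ℂ => 1 / ((Λ : ℂ) - w)) ∘ f = fun ζ => 1 / ((Λ : ℂ) - f ζ) := rfl
    rw [h2] at h1
    rw [h1, Finset.mul_sum]
    push_cast
    refine Finset.sum_congr rfl fun c _ => ?_
    rw [iteratedDeriv_one_div_const_sub, hfx, hterm]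
    push_cast
    have h3 : (-1 : ℂ) ^ k = ∏ i, (-1) ^ c.blocksFun i := by
      rw [Finset.prod_pow_eq_pow_sum, c.sum_blocksFun]
    rw [h3, mul_left_comm, ← Finset.prod_mul_distrib]
    congr 1
    refine Finset.prod_congr rfl fun i _ => ?_
    rw [← hφ, mul_div_assoc]
  have hle : term c ≤ C * (h ^ k * check M k) := by
    have h1 : term c ≤ ∑ c, term c := Finset.single_le_sum (fun c _ => hterm0 c) (Finset.mem_univ c)
    have h2 := congrArg norm hsum
    rw [Complex.norm_real, Real.norm_of_nonneg (Finset.sum_nonneg fun c _ => hterm0 c), norm_mul,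
      norm_pow, norm_neg, norm_one, one_pow, one_mul, norm_div, Complex.norm_natCast] at h2
    refine h1.trans (h2 ▸ ?_)
    rw [div_le_iff₀ hk]
    refine (hC _ hxs k).trans (le_of_eq ?_)
    rw [check]; field_simp
  have hprod : a ^ c.length * b ^ k * ∏ i, check M (c.blocksFun i) ≤
      ∏ i, (φ (c.blocksFun i) / (c.blocksFun i).factorial) := by
    calc _ = ∏ i, (a * b ^ c.blocksFun i * check M (c.blocksFun i)) := by
          rw [Finset.prod_mul_distrib, Finset.prod_mul_distrib, Finset.prod_pow_eq_pow_sum,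
            c.sum_blocksFun]
          simp
      _ ≤ _ := by
          refine Finset.prod_le_prod (fun i _ => ?_) fun i hi => ?_
          · have := check_pos hM (c.blocksFun i); positivity
          · have h1 := hx i hi
            rw [hφ, Complex.ofReal_re] at h1
            have : (0 : ℝ) < (c.blocksFun i).factorial := by exact_mod_cast Nat.factorial_pos _
            rw [check, ← mul_div_assoc]
            exact div_le_div_of_nonneg_right (by linarith) this.le
  have hck := check_pos hM k
  have hP : 0 ≤ ∏ i, check M (c.blocksFun i) := Finset.prod_nonneg fun i _ => (check_pos hM _).le
  have h1 : (Λ ^ (c.length + 1))⁻¹ * (a ^ c.length * b ^ k * ∏ i, check M (c.blocksFun i)) ≤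
      max 1 C * (h ^ k * check M k) := by
    refine le_trans ?_ (hle.trans (mul_le_mul_of_nonneg_right (le_max_right _ _) (by positivity)))
    refine mul_le_mul ?_ hprod (by positivity) (by positivity)
    exact inv_anti₀ (by positivity) (pow_le_pow_left₀ hΛφ.le (by linarith [hφ0 0]) _)
  have h2 : (Λ / a) ^ c.length ≤ D ^ k :=
    (pow_le_pow_left₀ (by positivity) (le_max_right _ _) _).trans
      (pow_le_pow_right₀ hD1 c.length_le)
  calc ∏ i, check M (c.blocksFun i)
      = Λ * (Λ / a) ^ c.length * (1 / b) ^ k * ((Λ ^ (c.length + 1))⁻¹ *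
          (a ^ c.length * b ^ k * ∏ i, check M (c.blocksFun i))) := by
        rw [pow_succ, div_pow, div_pow]; field_simp; simp
    _ ≤ Λ * D ^ k * (1 / b) ^ k * (max 1 C * (h ^ k * check M k)) := by gcongr
    _ = _ := by rw [div_pow, div_pow, mul_pow, one_pow]; field_simp

/-! ### Recovering the root almost increasing property -/

theorem gevreyBar_pow_le {β : ℝ} (hβ : 0 ≤ β) {p q : ℕ} (hpq : p ≤ q) :
    gevreyBar β p ^ q ≤ gevreyBar β q ^ p := by
  rw [gevreyBar, gevreyBar, ← Real.rpow_mul_natCast (Nat.cast_nonneg p),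
    ← Real.rpow_mul_natCast (Nat.cast_nonneg q),
    show (q : ℝ) * β * p = p * β * q by ring]
  exact Real.rpow_le_rpow (Nat.cast_nonneg p) (by exact_mod_cast hpq) (by positivity)

theorem LogConvex.pow_le {L : ℕ → ℝ} (hL : LogConvex L) (hpos : ∀ j, 0 < L j) {p q : ℕ}
    (hpq : p ≤ q) : L p ^ q ≤ L 0 ^ (q - p) * L q ^ p := by
  set r : ℝ := L (p + 1) / L p
  have hr : 0 < r := div_pos (hpos _) (hpos _)
  have h1 : L p ≤ L 0 * r ^ p := by simpa using hL.mul_ratio_pow_le hpos p 0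
  have h2 : L p * r ^ (q - p) ≤ L q := by
    have h3 := hL.mul_ratio_pow_le hpos p q
    change L p * r ^ q ≤ L q * r ^ p at h3
    rw [← Nat.sub_add_cancel hpq, pow_add, ← mul_assoc, Nat.sub_add_cancel hpq] at h3
    exact le_of_mul_le_mul_right h3 (by positivity)
  have hLp := hpos p
  have hL0 := hpos 0
  calc L p ^ q = L p ^ (q - p) * L p ^ p := by rw [← pow_add, Nat.sub_add_cancel hpq]
    _ ≤ (L 0 * r ^ p) ^ (q - p) * L p ^ p := by gcongr
    _ = L 0 ^ (q - p) * (L p * r ^ (q - p)) ^ p := by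
        rw [mul_pow, mul_pow, ← pow_mul, ← pow_mul, mul_comm p]; ring
    _ ≤ _ := by gcongr

/-- If `M` is equivalent to `j ^ (j β) L_j` with `L` log-convex, then `M̌_p ^ (1 / p)` is bounded by
a multiple of `M̌_q ^ (1 / q)` for `p ≤ q ≤ 2 p`; in this range the factorials do not matter. -/
theorem exists_check_pow_le {M L : ℕ → ℝ} {β : ℝ} (hM : ∀ j, 0 < M j) (hβ : 0 ≤ β)
    (hLpos : ∀ j, 0 < L j) (hL : LogConvex L)
    (hML : Preceq M fun j => L j * gevreyBar β j) (hLM : Preceq (fun j => L j * gevreyBar β j) M) :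
    ∃ D ≥ (1 : ℝ), ∀ p q : ℕ, 1 ≤ p → p ≤ q → q ≤ 2 * p →
      check M p ^ q ≤ D ^ (p * q) * check M q ^ p := by
  obtain ⟨A, hA, B, hB, hAB⟩ := hML
  obtain ⟨A', hA', B', hB', hAB'⟩ := hLM
  set A₁ := max 1 A
  set A₁' := max 1 A'
  set ℓ := max 1 (L 0)
  have hA₁ : 1 ≤ A₁ := le_max_left _ _
  have hA₁' : 1 ≤ A₁' := le_max_left _ _
  have hℓ : 1 ≤ ℓ := le_max_left _ _
  set D := max 1 (2 * Real.exp 1 * (A₁ * B * ℓ * A₁' * B'))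
  refine ⟨D, le_max_left _ _, fun p q hp hpq hq => ?_⟩
  have hGp := gevreyBar_pos (β := β) p
  have hGq := gevreyBar_pos (β := β) q
  have hMp := hM p
  have hMq := hM q
  have hLp := hLpos p
  have hLq := hLpos q
  have hL0 := hLpos 0
  have hM1 : M p ^ q ≤ (A₁ * B * ℓ * A₁' * B') ^ (p * q) * M q ^ p := by
    have hpq1 : q ≤ p * q := Nat.le_mul_of_pos_left q hp
    have hpq2 : p ≤ p * q := Nat.le_mul_of_pos_right p (by omega)
    calc M p ^ q ≤ (A * B ^ p * (L p * gevreyBar β p)) ^ q :=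
          pow_le_pow_left₀ hMp.le (hAB p) _
      _ = A ^ q * B ^ (p * q) * (L p ^ q * gevreyBar β p ^ q) := by
          rw [mul_pow, mul_pow, mul_pow, ← pow_mul]
      _ ≤ A ^ q * B ^ (p * q) * ((L 0 ^ (q - p) * L q ^ p) * gevreyBar β q ^ p) := by
          have h1 := hL.pow_le hLpos hpq
          have h2 := gevreyBar_pow_le hβ hpq
          gcongr
      _ = A ^ q * B ^ (p * q) * L 0 ^ (q - p) * (L q * gevreyBar β q) ^ p := by
          rw [mul_pow]; ring
      _ ≤ A ^ q * B ^ (p * q) * L 0 ^ (q - p) * (A' * B' ^ q * M q) ^ p := by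
          have := hAB' q
          dsimp only at this
          gcongr
      _ = A ^ q * B ^ (p * q) * L 0 ^ (q - p) * (A' ^ p * B' ^ (p * q) * M q ^ p) := by
          rw [mul_pow, mul_pow, ← pow_mul, mul_comm q p]
      _ ≤ A₁ ^ (p * q) * B ^ (p * q) * ℓ ^ (p * q) *
            (A₁' ^ (p * q) * B' ^ (p * q) * M q ^ p) := by
          have h1 : A ^ q ≤ A₁ ^ (p * q) := (pow_le_pow_left₀ hA.le (le_max_right _ _) _).trans
            (pow_le_pow_right₀ hA₁ hpq1)
          have h2 : A' ^ p ≤ A₁' ^ (p * q) := (pow_le_pow_left₀ hA'.le (le_max_right _ _) _).trans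
            (pow_le_pow_right₀ hA₁' hpq2)
          have h3 : L 0 ^ (q - p) ≤ ℓ ^ (p * q) :=
            (pow_le_pow_left₀ hL0.le (le_max_right _ _) _).trans
              (pow_le_pow_right₀ hℓ ((Nat.sub_le _ _).trans hpq1))
          gcongr
      _ = _ := by rw [mul_pow, mul_pow, mul_pow, mul_pow]; ring
  have hpf : (0 : ℝ) < p.factorial := by exact_mod_cast p.factorial_pos
  have hqf : (0 : ℝ) < q.factorial := by exact_mod_cast q.factorial_pos
  have hfac : (q.factorial : ℝ) ^ p ≤ (2 * Real.exp 1) ^ (p * q) * (p.factorial : ℝ) ^ q := by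
    have h1 : (p : ℝ) ^ p ≤ Real.exp 1 ^ p * p.factorial := by
      have := Real.pow_div_factorial_le_exp p (Nat.cast_nonneg p) p
      rwa [div_le_iff₀ hpf, ← mul_one (p : ℝ), Real.exp_nat_mul, mul_one] at this
    have h2 : (q.factorial : ℝ) ≤ (2 * p) ^ q := by
      have h3 : (q.factorial : ℝ) ≤ (q : ℝ) ^ q := by exact_mod_cast Nat.factorial_le_pow q
      have h4 : (q : ℝ) ≤ 2 * p := by exact_mod_cast hq
      exact h3.trans (pow_le_pow_left₀ (Nat.cast_nonneg q) h4 _)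
    calc (q.factorial : ℝ) ^ p ≤ ((2 * p) ^ q) ^ p := pow_le_pow_left₀ hqf.le h2 _
      _ = 2 ^ (p * q) * ((p : ℝ) ^ p) ^ q := by
          rw [← pow_mul, mul_pow, ← pow_mul, mul_comm q p]
      _ ≤ 2 ^ (p * q) * (Real.exp 1 ^ p * p.factorial) ^ q := by gcongr
      _ = _ := by rw [mul_pow, mul_pow, ← pow_mul]; ring
  have hck := check_pos hM q
  calc check M p ^ q = M p ^ q / (p.factorial : ℝ) ^ q := by rw [check, div_pow]
    _ ≤ (A₁ * B * ℓ * A₁' * B') ^ (p * q) * M q ^ p / (p.factorial : ℝ) ^ q := by gcongr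
    _ = (A₁ * B * ℓ * A₁' * B') ^ (p * q) * check M q ^ p *
          ((q.factorial : ℝ) ^ p / (p.factorial : ℝ) ^ q) := by
        rw [check, div_pow]; field_simp
    _ ≤ (A₁ * B * ℓ * A₁' * B') ^ (p * q) * check M q ^ p * (2 * Real.exp 1) ^ (p * q) := by
        have : (q.factorial : ℝ) ^ p / (p.factorial : ℝ) ^ q ≤ (2 * Real.exp 1) ^ (p * q) :=
          (div_le_iff₀ (by positivity)).2 hfac
        gcongr
    _ = (2 * Real.exp 1 * (A₁ * B * ℓ * A₁' * B')) ^ (p * q) * check M q ^ p := by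
        rw [mul_pow (2 * Real.exp 1)]; ring
    _ ≤ _ := by
        gcongr
        exact le_max_right _ _

theorem prod_blocksFun {n : ℕ} (c : Composition n) (φ : ℕ → ℝ) :
    ∏ i, φ (c.blocksFun i) = (c.blocks.map φ).prod := by
  conv_rhs => rw [← c.ofFn_blocksFun]
  rw [List.map_ofFn, List.prod_ofFn]
  rfl

/-- Writing `k = n p + q` with `p ≤ q < 2 p`, the product bound for `n` blocks `p` and one block
`q` compares `M̌_p` with `M̌_k`. -/
theorem rootAlmostIncreasing_of_prod_check_le {M : ℕ → ℝ} (hM : ∀ j, 0 < M j)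
    {C H : ℝ} (hC : 0 < C) (hH : 0 < H) (hprod : ∀ (k : ℕ) (c : Composition k),
      ∏ i, check M (c.blocksFun i) ≤ C * H ^ k * check M k)
    {D : ℝ} (hD : 1 ≤ D) (hdouble : ∀ p q : ℕ, 1 ≤ p → p ≤ q → q ≤ 2 * p →
      check M p ^ q ≤ D ^ (p * q) * check M q ^ p) :
    RootAlmostIncreasing M := by
  set C₁ := max 1 C
  have hC₁ : 1 ≤ C₁ := le_max_left _ _
  refine ⟨D * C₁ * H, by positivity, fun p k hp hpk => ?_⟩
  set n := k / p - 1 with hn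
  set q := k - n * p with hq
  have hdiv := Nat.div_add_mod k p
  have hmod := Nat.mod_lt k hp
  have hdiv1 : 1 ≤ k / p := (Nat.one_le_div_iff hp).2 hpk
  have hnp : n * p + p = p * (k / p) := by
    obtain ⟨m, hm⟩ : ∃ m, k / p = m + 1 := ⟨k / p - 1, by omega⟩
    rw [hn, hm, Nat.add_sub_cancel]; ring
  have hkq : n * p + q = k := by omega
  have hpq : p ≤ q := by omega
  have hq2 : q ≤ 2 * p := by omega
  have hqk : q ≤ k := by omega
  set c : Composition k := ⟨List.replicate n p ++ [q], by
    intro i hi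
    rcases List.mem_append.1 hi with h | h
    · rw [List.eq_of_mem_replicate h]; exact hp
    · rw [List.mem_singleton.1 h]; omega, by simp [hkq]⟩ with hc
  have h1 : check M p ^ n * check M q ≤ C * H ^ k * check M k := by
    have := hprod k c
    rw [prod_blocksFun] at this
    simpa [hc] using this
  have hcp := check_pos hM p
  have hcq := check_pos hM q
  have hck := check_pos hM k
  have hpow : check M p ^ k ≤ (D * C₁ * H) ^ (p * k) * check M k ^ p := by
    calc check M p ^ k = check M p ^ (n * p) * check M p ^ q := by rw [← pow_add, hkq]
      _ ≤ check M p ^ (n * p) * (D ^ (p * q) * check M q ^ p) := by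
          have := hdouble p q hp hpq hq2
          gcongr
      _ = D ^ (p * q) * (check M p ^ n * check M q) ^ p := by rw [mul_pow, pow_mul]; ring
      _ ≤ D ^ (p * q) * (C * H ^ k * check M k) ^ p := by gcongr
      _ = D ^ (p * q) * (C ^ p * H ^ (p * k) * check M k ^ p) := by
          rw [mul_pow, mul_pow, ← pow_mul, mul_comm k p]
      _ ≤ D ^ (p * k) * (C₁ ^ (p * k) * H ^ (p * k) * check M k ^ p) := by
          have h2 : C ^ p ≤ C₁ ^ (p * k) := (pow_le_pow_left₀ hC.le (le_max_right _ _) _).trans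
            (pow_le_pow_right₀ hC₁ (Nat.le_mul_of_pos_right p (by omega)))
          gcongr
      _ = _ := by rw [mul_pow, mul_pow]; ring
  have hp0 : p ≠ 0 := by omega
  have hk0 : k ≠ 0 := by omega
  refine le_of_pow_le_pow_left₀ (Nat.mul_ne_zero hp0 hk0)
    (mul_nonneg (by positivity) (Real.rpow_nonneg hck.le _)) ?_
  rw [mul_pow, pow_mul (check M p ^ (1 / (p : ℝ))), one_div, Real.rpow_inv_natCast_pow hcp.le hp0,
    mul_comm p k, pow_mul (check M k ^ (1 / (k : ℝ))), one_div, Real.rpow_inv_natCast_pow hck.le hk0,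
    mul_comm k p]
  exact hpow

theorem InverseClosed.rootAlmostIncreasing {M : ℕ → ℝ} (hM : ∀ j, 0 < M j) (hM0 : M 0 = 1)
    {α : ℝ} (hα : 1 < α)
    (hL : ∃ α' : ℝ, α < α' ∧ ∃ L : ℕ → ℝ, (∀ j, 0 < L j) ∧ LogConvex L ∧
      Equivalent (fun j => gevreyBar (1 - α') j * M j) L)
    (hinv : InverseClosed M α) : RootAlmostIncreasing M := by
  obtain ⟨α', hα', L, hLpos, hLc, ⟨A, hA, B, hB, hAB⟩, ⟨A', hA', B', hB', hAB'⟩⟩ := hL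
  set β := α' - 1 with hβ
  have hgev : ∀ j, gevreyBar (1 - α') j = (gevreyBar β j)⁻¹ := fun j => by
    rw [← gevreyBar_neg, hβ, neg_sub]
  simp only [hgev] at hAB hAB'
  have hML : Preceq M fun j => L j * gevreyBar β j := by
    refine ⟨A, hA, B, hB, fun j => ?_⟩
    have hG := gevreyBar_pos (β := β) j
    have h1 := mul_le_mul_of_nonneg_left (hAB j) hG.le
    rw [mul_inv_cancel_left₀ hG.ne'] at h1
    linarith
  have hLM : Preceq (fun j => L j * gevreyBar β j) M := by
    refine ⟨A', hA', B', hB', fun j => ?_⟩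
    have hG := gevreyBar_pos (β := β) j
    have h1 := mul_le_mul_of_nonneg_right (hAB' j) hG.le
    have h2 : A' * B' ^ j * ((gevreyBar β j)⁻¹ * M j) * gevreyBar β j = A' * B' ^ j * M j := by
      field_simp
    linarith
  obtain ⟨f, hf, hmono, a, ha, b, hb, hlow⟩ :=
    exists_completelyMonotone_mem_ultraClass hα (by linarith : α - 1 < β) hLpos hLc hML hLM
  obtain ⟨C, hC, H, hH, hprod⟩ :=
    hinv.exists_prod_check_le hM hM0 (by linarith) hf hmono ha hb hlow
  obtain ⟨D, hD, hdouble⟩ := exists_check_pow_le hM (by linarith : 0 ≤ β) hLpos hLc hML hLM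
  exact rootAlmostIncreasing_of_prod_check_le hM hC hH hprod hD hdouble

end Ultraholomorphic

theorem mainTheorem7 (M : ℕ → ℝ) (hM : ∀ j, 0 < M j) (hM0 : M 0 = 1)
    (α : ℝ) (hα : 1 < α)
    (hL : ∃ α' : ℝ, α < α' ∧ ∃ L : ℕ → ℝ, (∀ j, 0 < L j) ∧ Ultraholomorphic.LogConvex L ∧
      Ultraholomorphic.Equivalent (fun j => Ultraholomorphic.gevreyBar (1 - α') j * M j) L) :
    List.TFAE
      [Ultraholomorphic.RootAlmostIncreasing M,
       Ultraholomorphic.HolomorphicallyClosed M α,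
       Ultraholomorphic.InverseClosed M α] ∧
    (Ultraholomorphic.LiminfRootPos M → Ultraholomorphic.DerivationClosed M →
      List.TFAE
        [Ultraholomorphic.RootAlmostIncreasing M,
         Ultraholomorphic.HolomorphicallyClosed M α,
         Ultraholomorphic.InverseClosed M α,
         Ultraholomorphic.CompositionClosed M α,
         Ultraholomorphic.FaaDiBruno M]) := by
  have hab := fun h : Ultraholomorphic.RootAlmostIncreasing M =>
    h.holomorphicallyClosed hM hM0 α
  have hbc := fun h : Ultraholomorphic.HolomorphicallyClosed M α => h.inverseClosed
  have hca := fun h : Ultraholomorphic.InverseClosed M α =>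
    h.rootAlmostIncreasing hM hM0 hα hL
  refine ⟨?_, fun hlim hdc => ?_⟩
  · tfae_have 1 → 2 := hab
    tfae_have 2 → 3 := hbc
    tfae_have 3 → 1 := hca
    tfae_finish
  · tfae_have 1 → 2 := hab
    tfae_have 2 → 3 := hbc
    tfae_have 3 → 1 := hca
    tfae_have 1 → 5 := fun h => h.faaDiBruno hM hM0 hdc
    tfae_have 5 → 4 := fun h => h.compositionClosed hM hM0 α
    tfae_have 4 → 2 := fun h => h.holomorphicallyClosed hM hlim
    tfae_finish
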